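/- **Setting.** A (two-track) quantum Turing machine (QTM) $M$ consists of a finite set $Q$ of control states with an initial state $q_0$ and a final state $q_f\neq q_0$, the alphabet $\Sigma=\{0,1,\#\}\times\{0,1,\#\}$ (input track and output track, blank symbol $(\#,\#)$), and a transition function $Q\times\Sigma\to\mathbb C^{\Sigma\times Q\times\{L,R\}}$ such that the induced time evolution $U_M$ on $\mathbb C^Q\otimes\ell^2(T)\otimes\ell^2(\mathbb Z)$ (control, tape contents with finitely many non-blank cells indexed by $\mathbb Z$, head position) is unitary. A *classical description* of $M$ is a list of its states, with $q_0$ and $q_f$ marked, together with a program that computes the real and imaginary part of each transition amplitude to within $2^{-m}$, given the arguments of the transition function and $m\in\mathbb N_0$. (Thus the amplitudes are computable complex numbers; every QTM with polynomial-time computable amplitudes has such a description.) Let $\mathcal H_n=(\mathbb C^2)^{\otimes n}$ be the space of $n$ qubits. A unit vector $|\psi\rangle\in\mathcal H_n$ is identified with the initial state of $M$ in which $|\psi\rangle$ is written on cells $0,\dots,n-1$ of the input track, everything else is blank, the control is in state $q_0$ and the head at position $0$. Let $M_{\mathbf C}^t(|\psi\rangle)$ be the state of the control after $t$ steps, i.e.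 the partial trace over tape and head of $U_M^t|\psi\rangle\langle\psi|(U_M^*)^t$, and put $p_t(\psi)=\langle q_f|M_{\mathbf C}^t(|\psi\rangle)|q_f\rangle$. For an integer $t\ge 1$, the unit vector $|\psi\rangle$ is *$t$-halting* for $M$ if $p_t(\psi)=1$ and $p_{t'}(\psi)=0$ for all $0\le t'<t$; it is *$\varepsilon$-$t$-halting* if $p_t(\psi)\ge 1-\varepsilon$ and $p_{t'}(\psi)\le\varepsilon$ for all $0\le t'<t$. Let $H_M^{(n)}(t)$ be the set of $t$-halting unit vectors of $\mathcal H_n$. **Theorem (Computable Approximate Halting Spaces).** There is a classical algorithm that, given a classical description of a QTM $M$, integers $n\ge 0$, $t\ge 1$ and a rational $\delta>0$, always halts and computes a subspace $\mathcal H_M^{(n,\delta)}(t)\subseteq\mathcal H_n$ (described by a basis consisting of vectors with coordinates in $\mathbb Q+i\mathbb Q$) and a rational number $\varepsilon_M^{(n,\delta)}(t)>0$ (both may depend on the description of $M$) such that, with $H_M^{(n,\delta)}(t)$ denoting the set of unit vectors of $\mathcal H_M^{(n,\delta)}(t)$, the following holds for all $n\geq 0$, all $t,t'\geq 1$ and all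 rational $\delta,\Delta>0$. - *Almost-halting:* every $|\psi\rangle\in H_M^{(n,\delta)}(t)$ is $(20\,\delta)$-$t$-halting for $M$. - *Approximation:* for every $|\psi\rangle\in H_M^{(n)}(t)$ there is $|\psi^{(\delta)}\rangle\in H_M^{(n,\delta)}(t)$ with $\|\,|\psi\rangle-|\psi^{(\delta)}\rangle\|<\frac{11}{2}\delta$. - *Similarity:* if $\delta\le\frac1{80}\,\varepsilon_M^{(n,\Delta)}(t)$, then for every $|\psi\rangle\in H_M^{(n,\delta)}(t)$ there is $|\psi^{(\Delta)}\rangle\in H_M^{(n,\Delta)}(t)$ with $\|\,|\psi\rangle-|\psi^{(\Delta)}\rangle\|<\frac{11}{2}\Delta$. - *Almost-orthogonality:* if $|\psi_t\rangle\in H_M^{(n,\delta)}(t)$ and $|\psi_{t'}\rangle\in H_M^{(n,\delta)}(t')$ with $t\ne t'$, then $|\langle\psi_t|\psi_{t'}\rangle|\le 4\sqrt{5\delta}$. -/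

import Mathlib

/-! ### Configurations of a two-track Turing machine with two-way infinite tape -/

namespace QTuring

/-- The alphabet `{0, 1, #}` of one track; `none` is the blank `#`. -/
abbrev TrackSym : Type := Option Bool

/-- The alphabet `{0, 1, #} × {0, 1, #}`: a symbol on the input track, one on the output track. -/
abbrev Symb : Type := TrackSym × TrackSym

/-- The blank symbol `(#, #)`. -/
def blank : Symb := (none, none)

/-- Tape contents: cells indexed by `ℤ`, all but finitely many of them blank. -/
def Tape : Type := {x : ℤ → Symb // {i | x i ≠ blank}.Finite}

/-- Write the symbol `a` into cell `h`. -/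
def Tape.write (x : Tape) (h : ℤ) (a : Symb) : Tape :=
  ⟨Function.update x.1 h a, (x.2.union (Set.finite_singleton h)).subset (by
    intro i hi
    by_cases hih : i = h
    · exact Or.inr hih
    · left
      simpa [Function.update_of_ne hih] using hi)⟩

/-- The tape of an input of `n` bits: the bits stand on cells `0, …, n - 1` of the input track,
everything else is blank. -/
def Tape.input {n : ℕ} (s : Fin n → Bool) : Tape :=
  ⟨fun i => if h : 0 ≤ i ∧ i.toNat < n then (some (s ⟨i.toNat, h.2⟩), none) else blank,
    (Set.finite_Ico (0 : ℤ) n).subset (by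
      intro i hi
      by_cases h : 0 ≤ i ∧ i.toNat < n
      · exact ⟨h.1, by omega⟩
      · exact absurd (dif_neg h) hi)⟩

/-- Classical configurations: control state, tape contents, head position. -/
abbrev Config (k : ℕ) : Type := Fin k × Tape × ℤ

/-- The Hilbert space `ℂ^Q ⊗ ℓ²(T) ⊗ ℓ²(ℤ)` of the machine, as `ℓ²` of the configurations. -/
abbrev MachineSpace (k : ℕ) : Type := lp (fun _ : Config k => ℂ) 2

open Classical in
/-- The basis vector of a configuration. -/
noncomputable def ket {k : ℕ} (c : Config k) : MachineSpace k :=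
  lp.single 2 c (1 : ℂ)

/-- A transition function: `amp q a a' q' d` is the amplitude for writing `a'`, entering the
state `q'` and moving the head to the right (`d = true`) or to the left (`d = false`), when the
machine reads `a` in the state `q`. -/
abbrev Transition (k : ℕ) : Type := Fin k → Symb → Symb → Fin k → Bool → ℂ

/-- The head movement. -/
def shift (d : Bool) : ℤ := if d then 1 else -1

/-- The superposition that the transition function produces from a configuration in one step. -/
noncomputable def stepKet {k : ℕ} (amp : Transition k) (c : Config k) : MachineSpace k :=
  ∑ a' : Symb, ∑ q' : Fin k, ∑ d : Bool,
    amp c.1 (c.2.1.1 c.2.2) a' q' d • ket (q', c.2.1.write c.2.2 a', c.2.2 + shift d)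

end QTuring

/-- A two-track quantum Turing machine: a finite set of states with an initial state `q0` and a
final state `qf ≠ q0`, and a transition function over the alphabet `{0,1,#} × {0,1,#}` which
generates a unitary time evolution. -/
structure QTM where
  numStates : ℕ
  q0 : Fin numStates
  qf : Fin numStates
  qf_ne_q0 : qf ≠ q0
  amp : QTuring.Transition numStates
  unitary_evolution :
    ∃ U ∈ unitary (QTuring.MachineSpace numStates →L[ℂ] QTuring.MachineSpace numStates),
      ∀ c, U (QTuring.ket c) = QTuring.stepKet amp c

/-- The Hilbert space of `n` qubits; its computational basis is indexed by the bit strings of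
length `n`. -/
abbrev Qubits (n : ℕ) : Type := EuclideanSpace ℂ (Fin n → Bool)

namespace QTM

open QTuring

/-- The time evolution operator. -/
noncomputable def evol (M : QTM) : MachineSpace M.numStates →L[ℂ] MachineSpace M.numStates :=
  M.unitary_evolution.choose

/-- The embedding of `n`-qubit vectors as initial states: input on cells `0, …, n - 1` of the
input track, everything else blank, control in state `q0`, head in position `0`. -/
noncomputable def embed (M : QTM) (n : ℕ) : Qubits n →L[ℂ] MachineSpace M.numStates :=
  ∑ s : Fin n → Bool,
    (EuclideanSpace.proj s : Qubits n →L[ℂ] ℂ).smulRight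
      (ket ((M.q0, Tape.input s, 0) : Config M.numStates))

/-- The global state `U^t σ (U^*)^t` at time `t` on the `n`-qubit input `σ`. -/
noncomputable def globalState (M : QTM) {n : ℕ} (t : ℕ) (σ : Qubits n →L[ℂ] Qubits n) :
    MachineSpace M.numStates →L[ℂ] MachineSpace M.numStates :=
  (M.evol ^ t) ∘L (M.embed n ∘L σ ∘L ContinuousLinearMap.adjoint (M.embed n)) ∘L
    (ContinuousLinearMap.adjoint M.evol) ^ t

/-- The state of the control at time `t`: the partial trace of the global state over tape and
head, as a matrix indexed by the control states. -/
noncomputable def controlState (M : QTM) {n : ℕ} (t : ℕ) (σ : Qubits n →L[ℂ] Qubits n) :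
    Matrix (Fin M.numStates) (Fin M.numStates) ℂ :=
  fun q q' => ∑' y : Tape × ℤ,
    inner ℂ (ket ((q, y) : Config M.numStates)) (M.globalState t σ (ket (q', y)))

/-- The overlap `⟨q_f| M_C^t(|ψ⟩⟨ψ|) |q_f⟩` of the control with the final state, at time `t` on
the pure input `ψ`. -/
noncomputable def haltOverlap (M : QTM) {n : ℕ} (t : ℕ) (ψ : Qubits n) : ℝ :=
  (M.controlState t (InnerProductSpace.rankOne ℂ ψ ψ) M.qf M.qf).re

/-- `M` halts at time `t` on the normalized pure input `ψ`; that is, `ψ ∈ H_M^{(n)}(t)`. -/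
def IsHalting (M : QTM) {n : ℕ} (t : ℕ) (ψ : Qubits n) : Prop :=
  ‖ψ‖ = 1 ∧ M.haltOverlap t ψ = 1 ∧ ∀ t' < t, M.haltOverlap t' ψ = 0

/-- The normalized pure input `ψ` is `ε`-`t`-halting for `M`. -/
def IsEpsHalting (M : QTM) {n : ℕ} (ε : ℝ) (t : ℕ) (ψ : Qubits n) : Prop :=
  ‖ψ‖ = 1 ∧ 1 - ε ≤ M.haltOverlap t ψ ∧ ∀ t' < t, M.haltOverlap t' ψ ≤ ε

end QTM

/-! ### Finite data handled by classical algorithms -/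

/-- Fractions, as pairs of numerator and denominator. -/
abbrev RatCode : Type := ℤ × ℕ

/-- The rational number represented by a fraction. -/
def RatCode.val (r : RatCode) : ℚ := r.1 / r.2

/-- The representation of a rational number in lowest terms. -/
def RatCode.ofRat (r : ℚ) : RatCode := (r.num, r.den)

/-- Gaussian rationals, as pairs of real and imaginary part. -/
abbrev GaussCode : Type := RatCode × RatCode

/-- The complex number represented by a Gaussian rational. -/
noncomputable def GaussCode.val (z : GaussCode) : ℂ :=
  ((RatCode.val z.1 : ℝ) : ℂ) + ((RatCode.val z.2 : ℝ) : ℂ) * Complex.I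

/-- Vectors with coordinates in `ℚ + iℚ`, as lists of coordinates (missing entries are zero). -/
abbrev VecCode : Type := List GaussCode

/-- The vector of `n` qubits represented by a list: the coordinate belonging to the bit string
`s` is the entry with the number `∑ i, s i * 2 ^ i`. -/
noncomputable def VecCode.toQubits (n : ℕ) (v : VecCode) : Qubits n :=
  WithLp.toLp 2 fun s : Fin n → Bool =>
    GaussCode.val (v.getD (∑ i : Fin n, if s i then 2 ^ (i : ℕ) else 0) ((0, 1), (0, 1)))

/-- A list of vectors with coordinates in `ℚ + iℚ` describes the subspace `V` of the `n`-qubit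
space if it is a basis of `V`. -/
def DescribesSubspace {n : ℕ} (L : List VecCode) (V : Submodule ℂ (Qubits n)) : Prop :=
  LinearIndependent ℂ (fun i : Fin L.length => VecCode.toQubits n L[i]) ∧
    V = Submodule.span ℂ (Set.range fun i : Fin L.length => VecCode.toQubits n L[i])

/-- Classical descriptions of quantum Turing machines: the number of states, the initial state,
the final state, and a program for the transition amplitudes. -/
abbrev QTMCode : Type := ℕ × ℕ × ℕ × Nat.Partrec.Code

/-- The description `s` describes `M`: it lists the states of `M`, and its program computes the
real and imaginary part of every transition amplitude to within `2⁻ᵐ` from the arguments of the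
transition function and `m`. -/
def QTMCode.Describes (s : QTMCode) (M : QTM) : Prop :=
  s.1 = M.numStates ∧ s.2.1 = (M.q0 : ℕ) ∧ s.2.2.1 = (M.qf : ℕ) ∧
    ∀ (q : Fin M.numStates) (a a' : QTuring.Symb) (q' : Fin M.numStates) (d : Bool) (m : ℕ),
      ∃ z : GaussCode,
        Encodable.encode z ∈
          s.2.2.2.eval (Encodable.encode ((q : ℕ), a, a', (q' : ℕ), d, m)) ∧
        |(M.amp q a a' q' d).re - (RatCode.val z.1 : ℝ)| ≤ 2⁻¹ ^ m ∧
        |(M.amp q a a' q' d).im - (RatCode.val z.2 : ℝ)| ≤ 2⁻¹ ^ m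

/-! ### Primitive recursive integer arithmetic -/

section IntegerArithmetic

variable {α : Type*} [Primcodable α]

/-! Let `P_τ` be the compression to `n`-qubit inputs of the projection "control in `q_f` at time
`τ`", that is `P_τ = (haltOp τ)* (haltOp τ)`. Halting at time `t` is governed by the single operator
`A = 1 - P_t + ∑_{τ<t} P_τ` (`defectOp`). On a unit vector its quadratic form is `1 - p_t + ∑_{τ<t}
p_τ`, a sum of nonnegative terms. Hence a form value at most `ε` implies `ε`-`t`-halting, and
`ε`-`t`-halting implies a form value at most `(t+1)ε`. The `t`-halting vectors are the unit vectors
in the kernel of `A`.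

The entries of `A` are computable, but equality to zero of a computable number is not decidable, so
the exact kernel is replaced by something that can be certified. A certificate consists of `2^n`
Gaussian rational vectors in two groups, a number `g`, and an amount of fuel for the amplitude
program. It is accepted if the vectors are orthonormal and diagonalize `A` up to a tiny tolerance,
with diagonal entries that are tiny on the first group and larger than `1/g` on the second.
Acceptance is a primitive recursive test on a rational simulation of the machine, so an unbounded
search for an accepted certificate is partial recursive (`partrec_search`). The output space is the
span of the first group.

Completeness (`Describes.exists_accepts`): an orthonormal eigenbasis of `A` has a gap between zero
and its positive eigenvalues, and good rational approximations of it are accepted. Soundness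
(`Accepts.re_inner_le`, `Accepts.exists_near`): for every accepted certificate the form is small on
the span of the first group, and any unit vector with a small form value has a small component along
the second group. The span may also contain directions of tiny positive eigenvalues; this does no
harm.

With `D` the denominator of `δ` and `ε = 1/(8(t+1)gD²)`, every `ε/4`-`t`-halting vector lies within
`1/D ≤ δ` of a unit vector of the space. Approximation is the case of halting vectors. Similarity
follows since `δ ≤ ε/80` turns `20δ`-halting into `ε/4`-halting; the certificates for `δ` and `Δ`
need not be related. Almost-orthogonality holds for any approximately halting vectors, by comparing
the two evolutions at the earlier time (`IsEpsHalting.norm_inner_le`). -/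

theorem Int.encode_natCast (n : ℕ) : Encodable.encode (n : ℤ) = 2 * n := rfl

theorem Int.encode_negSucc (n : ℕ) : Encodable.encode (Int.negSucc n) = 2 * n + 1 := rfl

theorem Primrec.int_natCast : Primrec ((↑) : ℕ → ℤ) :=
  Primrec.encode_iff.1 (Primrec.nat_double.of_eq fun _ => rfl)

theorem Primrec.int_negSucc : Primrec Int.negSucc :=
  Primrec.encode_iff.1 (Primrec.nat_double_succ.of_eq fun _ => rfl)

/-- The encoding of `ℤ` interleaves the signs: even codes are the nonnegative integers, odd codes
the negative ones. Parity therefore decides the sign and halving recovers the size. -/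
theorem Primrec.int_toNat : Primrec Int.toNat := by
  have h : Primrec fun n : ℕ => if n % 2 = 0 then n / 2 else 0 :=
    Primrec.ite (Primrec.eq.comp (Primrec.nat_mod.comp .id (.const 2)) (.const 0))
      (Primrec.nat_div.comp .id (.const 2)) (.const 0)
  refine (h.comp (Primrec.encode (α := ℤ))).of_eq fun z => ?_
  rcases z with n | n
  · rw [Int.ofNat_eq_natCast, Int.encode_natCast]; simp
  · rw [Int.encode_negSucc, if_neg (by omega)]; rfl

theorem Primrec.int_toNat_neg : Primrec fun z : ℤ => (-z).toNat := by
  have h : Primrec fun n : ℕ => if n % 2 = 0 then 0 else n / 2 + 1 :=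
    Primrec.ite (Primrec.eq.comp (Primrec.nat_mod.comp .id (.const 2)) (.const 0))
      (.const 0) (Primrec.succ.comp (Primrec.nat_div.comp .id (.const 2)))
  refine (h.comp (Primrec.encode (α := ℤ))).of_eq fun z => ?_
  rcases z with n | n
  · rw [Int.ofNat_eq_natCast, Int.encode_natCast, if_pos (by omega)]; simp
  · rw [Int.encode_negSucc, if_neg (by omega), Int.neg_negSucc]; omega

theorem Primrec.int_natCast_sub : Primrec₂ fun a b : ℕ => (a : ℤ) - b := by
  have h : Primrec fun p : ℕ × ℕ =>
      if p.2 ≤ p.1 then ((p.1 - p.2 : ℕ) : ℤ) else Int.negSucc (p.2 - p.1 - 1) :=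
    Primrec.ite (Primrec.nat_le.comp .snd .fst)
      (Primrec.int_natCast.comp (Primrec.nat_sub.comp .fst .snd))
      (Primrec.int_negSucc.comp
        (Primrec.nat_sub.comp (Primrec.nat_sub.comp .snd .fst) (.const 1)))
  refine Primrec₂.mk (h.of_eq fun p => ?_)
  split_ifs with hp
  · omega
  · rw [Int.negSucc_eq]; omega

/-- Every `z` equals `z.toNat - (-z).toNat`, which reduces integer arithmetic and order to natural
numbers. -/
theorem Primrec.int_add : Primrec₂ ((· + ·) : ℤ → ℤ → ℤ) := by
  have h := Primrec.int_natCast_sub.comp (α := ℤ × ℤ)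
    (Primrec.nat_add.comp (Primrec.int_toNat.comp .fst) (Primrec.int_toNat.comp .snd))
    (Primrec.nat_add.comp (Primrec.int_toNat_neg.comp .fst) (Primrec.int_toNat_neg.comp .snd))
  exact Primrec₂.mk (h.of_eq fun p => by omega)

theorem Primrec.int_neg : Primrec (Neg.neg : ℤ → ℤ) :=
  (Primrec.int_natCast_sub.comp Primrec.int_toNat_neg Primrec.int_toNat).of_eq fun z => by omega

theorem Primrec.int_mul : Primrec₂ ((· * ·) : ℤ → ℤ → ℤ) := by
  have p1 : Primrec fun p : ℤ × ℤ => p.1.toNat := Primrec.int_toNat.comp .fst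
  have p2 : Primrec fun p : ℤ × ℤ => p.2.toNat := Primrec.int_toNat.comp .snd
  have m1 : Primrec fun p : ℤ × ℤ => (-p.1).toNat := Primrec.int_toNat_neg.comp .fst
  have m2 : Primrec fun p : ℤ × ℤ => (-p.2).toNat := Primrec.int_toNat_neg.comp .snd
  have h := Primrec.int_natCast_sub.comp
    (Primrec.nat_add.comp (Primrec.nat_mul.comp p1 p2) (Primrec.nat_mul.comp m1 m2))
    (Primrec.nat_add.comp (Primrec.nat_mul.comp p1 m2) (Primrec.nat_mul.comp m1 p2))
  refine Primrec₂.mk (h.of_eq fun p => ?_)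
  have e1 : p.1 = p.1.toNat - (-p.1).toNat := by omega
  have e2 : p.2 = p.2.toNat - (-p.2).toNat := by omega
  conv_rhs => rw [e1, e2]
  push_cast
  ring

theorem Primrec.int_le : PrimrecRel ((· ≤ ·) : ℤ → ℤ → Prop) := by
  have h := Primrec.nat_le.comp (α := ℤ × ℤ)
    (Primrec.nat_add.comp (Primrec.int_toNat.comp .fst) (Primrec.int_toNat_neg.comp .snd))
    (Primrec.nat_add.comp (Primrec.int_toNat.comp .snd) (Primrec.int_toNat_neg.comp .fst))
  refine PrimrecPred.primrecRel (p := fun p : ℤ × ℤ => p.1 ≤ p.2) (h.of_eq fun p => ?_)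
  obtain ⟨a, b⟩ := p
  dsimp only
  omega

end IntegerArithmetic

/-! ### Arithmetic of fractions and of Gaussian rationals -/

namespace RatCode

/-- Addition of fractions; a fraction with denominator `0` represents `0`. -/
def add (r s : RatCode) : RatCode :=
  if r.2 = 0 then s else if s.2 = 0 then r else (r.1 * s.2 + s.1 * r.2, r.2 * s.2)

/-- Multiplication of fractions. -/
def mul (r s : RatCode) : RatCode := (r.1 * s.1, r.2 * s.2)

/-- Negation of fractions. -/
def neg (r : RatCode) : RatCode := (-r.1, r.2)

theorem val_add (r s : RatCode) : (r.add s).val = r.val + s.val := by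
  unfold add
  split_ifs with h1 h2
  · simp [val, h1]
  · simp [val, h2]
  · have h1' : (r.2 : ℚ) ≠ 0 := by exact_mod_cast h1
    have h2' : (s.2 : ℚ) ≠ 0 := by exact_mod_cast h2
    simp only [val]
    push_cast
    field_simp

theorem val_mul (r s : RatCode) : (r.mul s).val = r.val * s.val := by
  simp only [val, mul]
  push_cast
  rw [mul_div_mul_comm]

theorem val_neg (r : RatCode) : (neg r).val = -r.val := by
  simp only [val, neg]
  push_cast
  rw [neg_div]

theorem val_ofRat (q : ℚ) : (ofRat q).val = q := Rat.num_div_den q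

/-- The fraction represents a number that is at most `1`. -/
def LeOne (r : RatCode) : Prop := r.2 = 0 ∨ r.1 ≤ r.2

instance : DecidablePred LeOne := fun r => inferInstanceAs (Decidable (r.2 = 0 ∨ r.1 ≤ r.2))

theorem leOne_iff (r : RatCode) : r.LeOne ↔ r.val ≤ 1 := by
  unfold LeOne val
  rcases Nat.eq_zero_or_pos r.2 with h | h
  · simp [h]
  · have h' : (0 : ℚ) < r.2 := by exact_mod_cast h
    rw [div_le_one h']
    constructor
    · rintro (h0 | h1)
      · omega
      · exact_mod_cast h1
    · intro h1
      exact Or.inr (by exact_mod_cast h1)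

theorem primrec_add : Primrec₂ add := by
  have p : Primrec fun x : RatCode × RatCode => x.1.1 := .comp .fst .fst
  have q : Primrec fun x : RatCode × RatCode => x.1.2 := .comp .snd .fst
  have r : Primrec fun x : RatCode × RatCode => x.2.1 := .comp .fst .snd
  have s : Primrec fun x : RatCode × RatCode => x.2.2 := .comp .snd .snd
  exact Primrec₂.mk <| .ite (Primrec.eq.comp q (.const 0)) .snd <|
    .ite (Primrec.eq.comp s (.const 0)) .fst <|
    .pair
      (Primrec.int_add.comp (Primrec.int_mul.comp p (Primrec.int_natCast.comp s))
        (Primrec.int_mul.comp r (Primrec.int_natCast.comp q)))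
      (Primrec.nat_mul.comp q s)

theorem primrec_mul : Primrec₂ mul :=
  Primrec₂.mk <| .pair
    (Primrec.int_mul.comp (.comp .fst .fst) (.comp .fst .snd))
    (Primrec.nat_mul.comp (.comp .snd .fst) (.comp .snd .snd))

theorem primrec_neg : Primrec neg := .pair (Primrec.int_neg.comp .fst) .snd

theorem primrecPred_leOne : PrimrecPred LeOne :=
  PrimrecPred.or (Primrec.eq.comp .snd (.const 0))
    (Primrec.int_le.comp .fst (Primrec.int_natCast.comp .snd))

end RatCode

namespace GaussCode

/-- The Gaussian rational of a natural number. -/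
def ofNat (k : ℕ) : GaussCode := ((k, 1), (0, 1))

/-- Addition of Gaussian rationals. -/
def add (z w : GaussCode) : GaussCode := (z.1.add w.1, z.2.add w.2)

/-- Negation of Gaussian rationals. -/
def neg (z : GaussCode) : GaussCode := (z.1.neg, z.2.neg)

/-- Conjugation of Gaussian rationals. -/
def conj (z : GaussCode) : GaussCode := (z.1, z.2.neg)

/-- Multiplication of Gaussian rationals. -/
def mul (z w : GaussCode) : GaussCode :=
  ((z.1.mul w.1).add (z.2.mul w.2).neg, (z.1.mul w.2).add (z.2.mul w.1))

/-- The sum of a list of Gaussian rationals. -/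
def sum (l : List GaussCode) : GaussCode := l.foldr add (ofNat 0)

/-- The Gaussian rational has absolute value at most `1 / X`. -/
def Small (X : ℕ) (z : GaussCode) : Prop :=
  RatCode.LeOne (((z.1.mul z.1).add (z.2.mul z.2)).mul ((X : ℤ) ^ 2, 1))

instance (X : ℕ) : DecidablePred (Small X) := fun _ => inferInstanceAs (Decidable (RatCode.LeOne _))

theorem val_ofNat (k : ℕ) : (ofNat k).val = k := by
  simp [val, ofNat, RatCode.val]

theorem val_add (z w : GaussCode) : (z.add w).val = z.val + w.val := by
  simp only [val, add, RatCode.val_add]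
  push_cast
  ring

theorem val_neg (z : GaussCode) : (neg z).val = -z.val := by
  simp only [val, neg, RatCode.val_neg]
  push_cast
  ring

theorem val_conj (z : GaussCode) : (conj z).val = (starRingEnd ℂ) z.val := by
  simp only [val, conj, RatCode.val_neg]
  simp

theorem val_mul (z w : GaussCode) : (z.mul w).val = z.val * w.val := by
  simp only [val, mul, RatCode.val_add, RatCode.val_mul, RatCode.val_neg]
  push_cast
  linear_combination -((RatCode.val z.2 : ℂ) * (RatCode.val w.2 : ℂ)) * Complex.I_sq

theorem val_sum (l : List GaussCode) : (sum l).val = (l.map val).sum := by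
  induction l with
  | nil => simp [sum, val_ofNat]
  | cons z l ih =>
    have : sum (z :: l) = z.add (sum l) := rfl
    rw [this, val_add, ih, List.map_cons, List.sum_cons]

theorem val_re (z : GaussCode) : z.val.re = (RatCode.val z.1 : ℝ) := by simp [val]

theorem val_im (z : GaussCode) : z.val.im = (RatCode.val z.2 : ℝ) := by simp [val]

/-- Squaring turns the bound into a comparison of rational numbers, which can be decided exactly. -/
theorem small_iff (X : ℕ) (z : GaussCode) : z.Small X ↔ X * ‖z.val‖ ≤ 1 := by
  have h : RatCode.val ((X : ℤ) ^ 2, 1) = (X : ℚ) ^ 2 := by simp [RatCode.val]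
  have h2 : ((X : ℝ) * ‖z.val‖) ^ 2
      = (((RatCode.val z.1 * RatCode.val z.1 + RatCode.val z.2 * RatCode.val z.2) *
        (X : ℚ) ^ 2 : ℚ) : ℝ) := by
    rw [mul_pow, ← Complex.normSq_eq_norm_sq, Complex.normSq_apply, val_re, val_im]
    push_cast
    ring
  rw [Small, RatCode.leOne_iff, RatCode.val_mul, RatCode.val_add, RatCode.val_mul,
    RatCode.val_mul, h, 
    ← sq_le_one_iff₀ (a := (X : ℝ) * ‖z.val‖) (by positivity), h2]
  norm_cast

theorem primrec_ofNat : Primrec ofNat :=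
  .pair (.pair Primrec.int_natCast (.const 1)) (.const (0, 1))

theorem primrec_add : Primrec₂ add :=
  Primrec₂.mk <| .pair (RatCode.primrec_add.comp (.comp .fst .fst) (.comp .fst .snd))
    (RatCode.primrec_add.comp (.comp .snd .fst) (.comp .snd .snd))

theorem primrec_neg : Primrec neg :=
  .pair (RatCode.primrec_neg.comp .fst) (RatCode.primrec_neg.comp .snd)

theorem primrec_conj : Primrec conj := .pair .fst (RatCode.primrec_neg.comp .snd)

theorem primrec_mul : Primrec₂ mul := by
  have p : Primrec fun x : GaussCode × GaussCode => x.1.1 := .comp .fst .fst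
  have q : Primrec fun x : GaussCode × GaussCode => x.1.2 := .comp .snd .fst
  have r : Primrec fun x : GaussCode × GaussCode => x.2.1 := .comp .fst .snd
  have s : Primrec fun x : GaussCode × GaussCode => x.2.2 := .comp .snd .snd
  exact Primrec₂.mk <| .pair
    (RatCode.primrec_add.comp (RatCode.primrec_mul.comp p r)
      (RatCode.primrec_neg.comp (RatCode.primrec_mul.comp q s)))
    (RatCode.primrec_add.comp (RatCode.primrec_mul.comp p s) (RatCode.primrec_mul.comp q r))

theorem primrec_sum : Primrec sum :=
  Primrec.list_foldr .id (.const _)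
    (primrec_add.comp (.comp .fst .snd) (.comp .snd .snd)).to₂

theorem primrecRel_small : PrimrecRel Small := by
  have p : Primrec fun x : ℕ × GaussCode => x.2.1 := .comp .fst .snd
  have q : Primrec fun x : ℕ × GaussCode => x.2.2 := .comp .snd .snd
  have r : Primrec fun x : ℕ × GaussCode => (x.1 : ℤ) := Primrec.int_natCast.comp .fst
  exact PrimrecPred.primrecRel <| RatCode.primrecPred_leOne.comp <| RatCode.primrec_mul.comp
    (RatCode.primrec_add.comp (RatCode.primrec_mul.comp p p) (RatCode.primrec_mul.comp q q))
    (.pair ((Primrec.int_mul.comp r r).of_eq fun x => (sq _).symm) (.const 1))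

end GaussCode

/-! ### Simulation of a machine by finite sums of weighted configurations -/

namespace QTuring

/-- Codes of configurations: the control state, a finite window of the tape, and the position of
the head in the window. -/
abbrev ConfCode : Type := ℕ × List Symb × ℕ

/-- Moves: the symbol written, the state entered, and the direction. -/
abbrev Move : Type := Symb × ℕ × Bool

/-- Finite sums of configurations with Gaussian rational coefficients. -/
abbrev Terms : Type := List (ConfCode × GaussCode)

/-- The symbol under the head. -/
def ConfCode.read (c : ConfCode) : Symb := c.2.1.getD c.2.2 blank

/-- The configuration after a move. -/
def ConfCode.move (c : ConfCode) (mv : Move) : ConfCode :=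
  (mv.2.1, c.2.1.set c.2.2 mv.1, if mv.2.2 then c.2.2 + 1 else c.2.2 - 1)

/-- The list of the moves of a machine with `k` states. -/
noncomputable def moves (k : ℕ) : List Move :=
  (Finset.univ : Finset Symb).toList.flatMap fun a =>
    (List.range k).flatMap fun q => [(a, q, true), (a, q, false)]

/-- One step of the simulation. -/
noncomputable def stepTerms (k : ℕ) (amp : ℕ → Symb → Move → GaussCode) (l : Terms) : Terms :=
  l.flatMap fun x => (moves k).map fun mv =>
    (x.1.move mv, x.2.mul (amp x.1.1 x.1.read mv))

/-- The initial tape window with margins of width `T` for the `j`-th bit string of length `n`. -/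
def inputWindow (n T j : ℕ) : List Symb :=
  (List.range (n + 2 * T)).map fun i =>
    if T ≤ i ∧ i < T + n then (some (decide (j / 2 ^ (i - T) % 2 = 1)), none) else blank

/-- The initial sum of configurations for a coded vector. -/
def initTerms (q0 n T : ℕ) (v : VecCode) : Terms :=
  (List.range (2 ^ n)).map fun j =>
    ((q0, inputWindow n T j, T), v.getD j ((0, 1), (0, 1)))

/-- The part of the sum in which the control is in the given state. -/
def restrictState (qf : ℕ) (l : Terms) : Terms :=
  l.flatMap fun x => if x.1.1 = qf then [x] else []

/-- The inner product of two sums of configurations. -/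
def gram (l l' : Terms) : GaussCode :=
  GaussCode.sum <| l.flatMap fun x => l'.map fun y =>
    if x.1 = y.1 then x.2.conj.mul y.2 else GaussCode.ofNat 0

end QTuring

/-! ### Certificates and the acceptance test -/

namespace QTMCode

open QTuring

/-- The approximation of a transition amplitude that the program of the description computes with
the given amount of fuel. -/
def ampCode (s : QTMCode) (fuel m : ℕ) (q : ℕ) (a : Symb) (mv : Move) : Option GaussCode :=
  (Nat.Partrec.Code.evaln fuel s.2.2.2
    (Encodable.encode (q, a, mv.1, mv.2.1, mv.2.2, m))).bind Encodable.decode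

/-- The approximate state at time `τ`. -/
noncomputable def run (s : QTMCode) (fuel m n T τ : ℕ) (v : VecCode) : Terms :=
  (stepTerms s.1 fun q a mv => (s.ampCode fuel m q a mv).getD (GaussCode.ofNat 0))^[τ]
    (initTerms s.2.1 n T v)

/-- The approximate overlap of two evolved vectors in the final state at time `τ`. -/
noncomputable def overlap (s : QTMCode) (fuel m n T τ : ℕ) (v w : VecCode) : GaussCode :=
  gram (restrictState s.2.2.1 (s.run fuel m n T τ v)) (restrictState s.2.2.1 (s.run fuel m n T τ w))

/-- The approximate matrix entry of the operator that measures the deviation from halting at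
time `t`. -/
noncomputable def defect (s : QTMCode) (fuel m n t : ℕ) (v w : VecCode) : GaussCode :=
  ((gram (initTerms s.2.1 n t v) (initTerms s.2.1 n t w)).add (s.overlap fuel m n t t v w).neg).add
    (GaussCode.sum ((List.range t).map fun τ => s.overlap fuel m n t τ v w))

/-- Certificates: vectors spanning the approximate halting space, vectors spanning a complement,
a bound for the inverse of the spectral gap, and the fuel. -/
abbrev Certificate : Type := (List VecCode × List VecCode) × ℕ × ℕ

/-- The inputs of the algorithm. -/
abbrev Input : Type := QTMCode × ℕ × ℕ × RatCode

/-- The inverse of the tolerance for matrix entries. -/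
def tolerance (x : Input) (c : Certificate) : ℕ :=
  -- With `g = c.2.1` and `D` the denominator of `δ`, the tolerance `X` satisfies `2^n · (2/X) =
  -- 1/(64gD²)`. Errors in the quadratic form then amount to at most `1/(32gD²)` on unit vectors.
  128 * 2 ^ x.2.1 * c.2.1 * x.2.2.2.2 ^ 2

/-- The number of binary digits to which the transition amplitudes are computed. -/
def precision (x : Input) (c : Certificate) : ℕ :=
  -- This is `2X` times the coefficient of `2⁻ᵐ` in the error bound for an entry. Since `m · 2⁻ᵐ ≤
  -- 1`, choosing `m` equal to it keeps that error below `1/(2X)`.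
  40 * (x.2.2.1 + 1) * (36 * x.1.1) ^ x.2.2.1 * 2 ^ x.2.1 * tolerance x c

/-- The `i`-th vector of a certificate. -/
def Certificate.vec (c : Certificate) (i : ℕ) : VecCode := (c.1.1 ++ c.1.2).getD i []

/-- The approximate matrix entries of the deviation from halting. -/
noncomputable def entry (x : Input) (c : Certificate) (i j : ℕ) : GaussCode :=
  x.1.defect c.2.2 (precision x c) x.2.1 x.2.2.1 (c.vec i) (c.vec j)

/-- The fuel suffices to compute all transition amplitudes. -/
def Fueled (x : Input) (c : Certificate) : Prop :=
  ∀ q < x.1.1, ∀ a ∈ (Finset.univ : Finset Symb).toList, ∀ mv ∈ moves x.1.1,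
    (x.1.ampCode c.2.2 (precision x c) q a mv).isSome

/-- The vectors are nearly orthonormal and nearly diagonalize the deviation from halting. -/
def NearlyDiagonal (x : Input) (c : Certificate) : Prop :=
  ∀ i < 2 ^ x.2.1, ∀ j < 2 ^ x.2.1,
    ((gram (initTerms x.1.2.1 x.2.1 x.2.2.1 (c.vec i))
        (initTerms x.1.2.1 x.2.1 x.2.2.1 (c.vec j))).add
      (GaussCode.ofNat (if i = j then 1 else 0)).neg).Small (tolerance x c) ∧
    -- Only the diagonal entries of the second group must be large; all other entries must vanish up
    -- to the tolerance.
    (if i = j ∧ c.1.1.length ≤ i then ¬ (entry x c i j).Small c.2.1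
      else (entry x c i j).Small (tolerance x c))

/-- The certificate is accepted. -/
def Accepts (x : Input) (c : Certificate) : Prop :=
  ((c.1.1 ++ c.1.2).length = 2 ^ x.2.1 ∧ 0 < c.2.1) ∧ Fueled x c ∧ NearlyDiagonal x c

/-- The output belonging to a certificate. -/
def output (x : Input) (c : Certificate) : List VecCode × RatCode :=
  -- The factor `8(t+1)` is chosen so that `(t+1) · ε/4 = 1/(32gD²)`, the threshold on the quadratic
  -- form in `Accepts.exists_near`.
  (c.1.1, (1, 8 * (x.2.2.1 + 1) * c.2.1 * x.2.2.2.2 ^ 2))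

open Classical in
/-- The search for an accepted certificate. -/
noncomputable def search (x : Input) : Part (List VecCode × RatCode) :=
  Nat.rfindOpt fun k => (Encodable.decode k : Option Certificate).bind fun c =>
    if Accepts x c then some (output x c) else none

end QTMCode

/-! ### The simulation is primitive recursive -/

namespace QTuring

variable {α : Type*} [Primcodable α]

theorem primrec_nat_pow : Primrec₂ ((· ^ ·) : ℕ → ℕ → ℕ) :=
  Primrec₂.unpaired'.1 Nat.Primrec.pow

theorem primrec_read : Primrec ConfCode.read :=
  (Primrec.list_getD blank).comp (.comp .fst .snd) (.comp .snd .snd)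

theorem primrec_move : Primrec₂ ConfCode.move := by
  have h : Primrec fun x : ConfCode × Move => x.1.2.2 := .comp .snd (.comp .snd .fst)
  exact Primrec₂.mk <| .pair (.comp .fst (.comp .snd .snd)) <| .pair
    (Primrec.list_set.comp (.comp .fst (.comp .snd .fst)) (.pair h (.comp .fst .snd)))
    ((Primrec.cond (.comp .snd (.comp .snd .snd)) (Primrec.succ.comp h)
      (Primrec.nat_sub.comp h (.const 1))).of_eq fun x => by
        cases x.2.2.2 <;> simp)

theorem primrec_moves : Primrec moves := by
  refine Primrec.list_flatMap (.const _) 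
    (Primrec₂.mk (Primrec.list_flatMap (Primrec.list_range.comp .fst) ?_))
  have h (d : Bool) : Primrec fun p : (ℕ × Symb) × ℕ => ((p.1.2, p.2, d) : Move) :=
    .pair (.comp .snd .fst) (.pair .snd (.const d))
  exact (Primrec.list_cons.comp (h true) (Primrec.list_cons.comp (h false) (.const []))).to₂

theorem primrec_stepTerms {k : α → ℕ} {amp : α → ℕ → Symb → Move → GaussCode} {l : α → Terms}
    (hk : Primrec k) (hamp : Primrec fun p : α × ℕ × Symb × Move => amp p.1 p.2.1 p.2.2.1 p.2.2.2)
    (hl : Primrec l) : Primrec fun a => stepTerms (k a) (amp a) (l a) := by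
  refine Primrec.list_flatMap hl
    (Primrec₂.mk (Primrec.list_map (primrec_moves.comp (hk.comp .fst)) ?_))
  have hx : Primrec fun p : (α × ConfCode × GaussCode) × Move => p.1.2 := .comp .snd .fst
  have hc : Primrec fun p : (α × ConfCode × GaussCode) × Move => p.1.2.1 := .comp .fst hx
  have ha := hamp.comp (Primrec.pair (Primrec.fst.comp Primrec.fst)
    (.pair (.comp .fst hc) (.pair (primrec_read.comp hc) .snd)))
  exact Primrec₂.mk (.pair (primrec_move.comp hc .snd)
    (GaussCode.primrec_mul.comp (.comp .snd hx) ha))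

theorem primrec_inputWindow : Primrec fun p : ℕ × ℕ × ℕ => inputWindow p.1 p.2.1 p.2.2 := by
  refine Primrec.list_map (Primrec.list_range.comp (Primrec.nat_add.comp .fst
    (Primrec.nat_mul.comp (.const 2) (.comp .fst .snd)))) ?_
  have n : Primrec fun p : (ℕ × ℕ × ℕ) × ℕ => p.1.1 := .comp .fst .fst
  have T : Primrec fun p : (ℕ × ℕ × ℕ) × ℕ => p.1.2.1 := .comp .fst (.comp .snd .fst)
  have j : Primrec fun p : (ℕ × ℕ × ℕ) × ℕ => p.1.2.2 := .comp .snd (.comp .snd .fst)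
  have hd := (Primrec.eq (α := ℕ)).decide.comp (Primrec.nat_mod.comp
    (Primrec.nat_div.comp j (primrec_nat_pow.comp (.const 2) (Primrec.nat_sub.comp .snd T)))
    (.const 2)) (.const 1)
  exact (Primrec.ite (PrimrecPred.and (Primrec.nat_le.comp T .snd)
    (Primrec.nat_lt.comp .snd (Primrec.nat_add.comp T n)))
    (.pair (Primrec.option_some.comp hd) (.const none)) (.const blank)).to₂

theorem primrec_initTerms :
    Primrec fun p : ℕ × ℕ × ℕ × VecCode => initTerms p.1 p.2.1 p.2.2.1 p.2.2.2 := by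
  refine Primrec.list_map
    (Primrec.list_range.comp (primrec_nat_pow.comp (.const 2) (.comp .fst .snd))) ?_
  have q : Primrec fun p : (ℕ × ℕ × ℕ × VecCode) × ℕ => p.1.1 := .comp .fst .fst
  have n : Primrec fun p : (ℕ × ℕ × ℕ × VecCode) × ℕ => p.1.2.1 := .comp .fst (.comp .snd .fst)
  have T : Primrec fun p : (ℕ × ℕ × ℕ × VecCode) × ℕ => p.1.2.2.1 :=
    .comp .fst (.comp .snd (.comp .snd .fst))
  have v : Primrec fun p : (ℕ × ℕ × ℕ × VecCode) × ℕ => p.1.2.2.2 :=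
    .comp .snd (.comp .snd (.comp .snd .fst))
  exact (Primrec.pair (.pair q (.pair (primrec_inputWindow.comp (.pair n (.pair T .snd))) T))
    ((Primrec.list_getD _).comp v .snd)).to₂

theorem primrec_initTerms_comp {q n T : α → ℕ} {v : α → VecCode} (hq : Primrec q)
    (hn : Primrec n) (hT : Primrec T) (hv : Primrec v) :
    Primrec fun a => initTerms (q a) (n a) (T a) (v a) :=
  primrec_initTerms.comp (.pair hq (.pair hn (.pair hT hv)))

theorem primrec_restrictState : Primrec₂ restrictState := by
  refine Primrec₂.mk (Primrec.list_flatMap .snd (Primrec₂.mk (Primrec.ite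
    (Primrec.eq.comp ?_ ?_) (Primrec.list_cons.comp .snd (.const [])) (.const []))))
  · exact .comp .fst (.comp .fst .snd)
  · exact .comp .fst .fst

theorem primrec_gram : Primrec₂ gram := by
  refine Primrec₂.mk (GaussCode.primrec_sum.comp (Primrec.list_flatMap .fst (Primrec₂.mk
    (Primrec.list_map (.comp .snd .fst) (Primrec₂.mk (Primrec.ite (Primrec.eq.comp ?_ ?_)
      (GaussCode.primrec_mul.comp (GaussCode.primrec_conj.comp ?_) ?_) (.const _)))))))
  · exact .comp .fst (.comp .snd .fst)
  · exact .comp .fst .snd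
  · exact .comp .snd (.comp .snd .fst)
  · exact .comp .snd .snd

end QTuring

/-! ### Computability of the acceptance test and of the search -/

namespace QTMCode

open QTuring

variable {α : Type*} [Primcodable α]

theorem primrec_ampCode {s : α → QTMCode} {fuel m q : α → ℕ} {a : α → Symb} {mv : α → Move}
    (hs : Primrec s) (hfuel : Primrec fuel) (hm : Primrec m) (hq : Primrec q) (ha : Primrec a)
    (hmv : Primrec mv) :
    Primrec fun x => (s x).ampCode (fuel x) (m x) (q x) (a x) (mv x) := by
  have harg : Primrec fun x => (q x, a x, (mv x).1, (mv x).2.1, (mv x).2.2, m x) :=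
    .pair hq (.pair ha (.pair (.comp .fst hmv) (.pair (.comp .fst (.comp .snd hmv))
      (.pair (.comp .snd (.comp .snd hmv)) hm))))
  have hcode : Primrec fun x => (s x).2.2.2 := .comp .snd (.comp .snd (.comp .snd hs))
  exact Primrec.option_bind (Nat.Partrec.Code.primrec_evaln.comp
    (.pair (.pair hfuel hcode) (Primrec.encode.comp harg)))
    (Primrec₂.mk (Primrec.decode.comp .snd))

theorem primrec_run {s : α → QTMCode} {fuel m n T τ : α → ℕ} {v : α → VecCode}
    (hs : Primrec s) (hfuel : Primrec fuel) (hm : Primrec m) (hn : Primrec n) (hT : Primrec T)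
    (hτ : Primrec τ) (hv : Primrec v) :
    Primrec fun x => (s x).run (fuel x) (m x) (n x) (T x) (τ x) (v x) := by
  have h0 : Primrec fun x => initTerms (s x).2.1 (n x) (T x) (v x) := 
    primrec_initTerms_comp (.comp .fst (.comp .snd hs)) hn hT hv
  have h : Primrec fun p : (α × Terms) × ℕ × Symb × Move => p.1.1 := .comp .fst .fst
  have hamp : Primrec fun p : (α × Terms) × ℕ × Symb × Move =>
      ((s p.1.1).ampCode (fuel p.1.1) (m p.1.1) p.2.1 p.2.2.1 p.2.2.2).getD (GaussCode.ofNat 0) :=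
    Primrec.option_getD.comp (primrec_ampCode (hs.comp h) (hfuel.comp h) (hm.comp h)
      (Primrec.fst.comp .snd) (Primrec.fst.comp (Primrec.snd.comp .snd))
      (Primrec.snd.comp (Primrec.snd.comp .snd))) (.const (GaussCode.ofNat 0))
  have hstep : Primrec fun p : α × Terms => stepTerms (s p.1).1
      (fun q a mv => ((s p.1).ampCode (fuel p.1) (m p.1) q a mv).getD (GaussCode.ofNat 0)) p.2 :=
    primrec_stepTerms (.comp .fst (hs.comp .fst)) hamp .snd
  exact Primrec.nat_iterate hτ h0 (Primrec₂.mk hstep)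

theorem primrec_overlap {s : α → QTMCode} {fuel m n T τ : α → ℕ} {v w : α → VecCode}
    (hs : Primrec s) (hfuel : Primrec fuel) (hm : Primrec m) (hn : Primrec n) (hT : Primrec T)
    (hτ : Primrec τ) (hv : Primrec v) (hw : Primrec w) :
    Primrec fun x => (s x).overlap (fuel x) (m x) (n x) (T x) (τ x) (v x) (w x) := by
  have hf : Primrec fun x => (s x).2.2.1 := .comp .fst (.comp .snd (.comp .snd hs))
  exact primrec_gram.comp
    (primrec_restrictState.comp hf (primrec_run hs hfuel hm hn hT hτ hv))
    (primrec_restrictState.comp hf (primrec_run hs hfuel hm hn hT hτ hw))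

theorem primrec_defect {s : α → QTMCode} {fuel m n t : α → ℕ} {v w : α → VecCode}
    (hs : Primrec s) (hfuel : Primrec fuel) (hm : Primrec m) (hn : Primrec n) (ht : Primrec t)
    (hv : Primrec v) (hw : Primrec w) :
    Primrec fun x => (s x).defect (fuel x) (m x) (n x) (t x) (v x) (w x) := by
  have hq : Primrec fun x => (s x).2.1 := .comp .fst (.comp .snd hs)
  refine GaussCode.primrec_add.comp (GaussCode.primrec_add.comp (primrec_gram.comp
    (primrec_initTerms_comp hq hn ht hv)
    (primrec_initTerms_comp hq hn ht hw))
    (GaussCode.primrec_neg.comp (primrec_overlap hs hfuel hm hn ht ht hv hw)))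
    (GaussCode.primrec_sum.comp (Primrec.list_map (Primrec.list_range.comp ht) ?_))
  exact (primrec_overlap (hs.comp .fst) (hfuel.comp .fst) (hm.comp .fst) (hn.comp .fst)
    (ht.comp .fst) .snd (hv.comp .fst) (hw.comp .fst)).to₂

theorem primrec_tolerance : Primrec₂ tolerance := by
  have n : Primrec fun p : Input × Certificate => 2 ^ p.1.2.1 :=
    primrec_nat_pow.comp (.const 2) (.comp .fst (.comp .snd .fst))
  have g : Primrec fun p : Input × Certificate => p.2.2.1 := .comp .fst (.comp .snd .snd)
  have d : Primrec fun p : Input × Certificate => p.1.2.2.2.2 ^ 2 :=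
    primrec_nat_pow.comp (.comp .snd (.comp .snd (.comp .snd (.comp .snd .fst)))) (.const 2)
  have c : Primrec fun _ : Input × Certificate => 128 := .const 128
  exact Primrec₂.mk (Primrec.nat_mul.comp (Primrec.nat_mul.comp (Primrec.nat_mul.comp c n) g) d)

theorem primrec_precision : Primrec₂ precision := by
  have t : Primrec fun p : Input × Certificate => p.1.2.2.1 :=
    .comp .fst (.comp .snd (.comp .snd .fst))
  have t1 : Primrec fun p : Input × Certificate => p.1.2.2.1 + 1 := Primrec.succ.comp t
  have n : Primrec fun p : Input × Certificate => 2 ^ p.1.2.1 :=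
    primrec_nat_pow.comp (.const 2) (.comp .fst (.comp .snd .fst))
  have k : Primrec fun p : Input × Certificate => 36 * p.1.1.1 :=
    Primrec.nat_mul.comp (.const 36) (.comp .fst (.comp .fst .fst))
  have c : Primrec fun _ : Input × Certificate => 40 := .const 40
  have h : Primrec fun p : Input × Certificate => tolerance p.1 p.2 := primrec_tolerance
  exact Primrec₂.mk (Primrec.nat_mul.comp (Primrec.nat_mul.comp (Primrec.nat_mul.comp
    (Primrec.nat_mul.comp c t1) (primrec_nat_pow.comp k t)) n) h)

theorem primrec_vec : Primrec₂ Certificate.vec := by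
  have l : Primrec fun p : Certificate × ℕ => p.1.1.1 ++ p.1.1.2 :=
    Primrec.list_append.comp (.comp .fst (.comp .fst .fst)) (.comp .snd (.comp .fst .fst))
  exact Primrec₂.mk ((Primrec.list_getD []).comp l .snd)

theorem primrec_entry {x : α → Input} {c : α → Certificate} {i j : α → ℕ}
    (hx : Primrec x) (hc : Primrec c) (hi : Primrec i) (hj : Primrec j) :
    Primrec fun p => entry (x p) (c p) (i p) (j p) :=
  primrec_defect (.comp .fst hx) (.comp .snd (.comp .snd hc)) (primrec_precision.comp hx hc)
    (.comp .fst (.comp .snd hx)) (.comp .fst (.comp .snd (.comp .snd hx)))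
    (primrec_vec.comp hc hi) (primrec_vec.comp hc hj)

end QTMCode

theorem PrimrecPred.forall_mem_list_comp {α β : Type*} [Primcodable α] [Primcodable β]
    {p : α × β → Prop} (h : PrimrecPred p) {l : β → List α} (hl : Primrec l) :
    PrimrecPred fun b => ∀ a ∈ l b, p (a, b) :=
  PrimrecRel.comp (R := fun (l : List α) (b : β) => ∀ a ∈ l, p (a, b))
    (PrimrecRel.forall_mem_list (R := fun (a : α) (b : β) => p (a, b)) (PrimrecPred.primrecRel h))
    hl Primrec.id

theorem PrimrecPred.forall_lt_comp {β : Type*} [Primcodable β] {p : ℕ × β → Prop}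
    (h : PrimrecPred p) {k : β → ℕ} (hk : Primrec k) :
    PrimrecPred fun b => ∀ q < k b, p (q, b) :=
  (h.forall_mem_list_comp (Primrec.list_range.comp hk)).of_eq fun b => by simp

theorem PrimrecPred.ite_prop {α : Type*} [Primcodable α] {p q r : α → Prop} [DecidablePred p]
    (hp : PrimrecPred p) (hq : PrimrecPred q) (hr : PrimrecPred r) :
    PrimrecPred fun a => if p a then q a else r a :=
  ((hp.and hq).or (hp.not.and hr)).of_eq fun a => by
    by_cases h : p a <;> simp [h]

namespace QTMCode

open QTuring

theorem primrecRel_fueled : PrimrecRel Fueled := by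
  -- The innermost quantified variable stands first in the tuple, so that each bounded quantifier
  -- removes the head and leaves the input and the certificate as parameters.
  have hp : Primrec fun p : Move × Symb × ℕ × Input × Certificate => p.2.2.2 :=
    .comp .snd (.comp .snd .snd)
  have hm : Primrec fun p : Move × Symb × ℕ × Input × Certificate =>
      precision p.2.2.2.1 p.2.2.2.2 := primrec_precision.comp (.comp .fst hp) (.comp .snd hp)
  have hamp : Primrec fun p : Move × Symb × ℕ × Input × Certificate =>
      p.2.2.2.1.1.ampCode p.2.2.2.2.2.2 (precision p.2.2.2.1 p.2.2.2.2) p.2.2.1 p.2.1 p.1 :=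
    primrec_ampCode (.comp .fst (.comp .fst hp)) (.comp .snd (.comp .snd (.comp .snd hp))) hm
      (.comp .fst (.comp .snd .snd)) (.comp .fst .snd) .fst
  have h : PrimrecPred fun p : Move × Symb × ℕ × Input × Certificate =>
      (p.2.2.2.1.1.ampCode p.2.2.2.2.2.2 (precision p.2.2.2.1 p.2.2.2.2) p.2.2.1 p.2.1
        p.1).isSome = true :=
    Primrec.eq.comp (Primrec.option_isSome.comp hamp) (.const true)
  have hmv : Primrec fun p : Symb × ℕ × Input × Certificate => moves p.2.2.1.1.1 :=
    primrec_moves.comp (.comp .fst (.comp .fst (.comp .fst (.comp .snd .snd))))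
  have h1 : PrimrecPred fun p : Symb × ℕ × Input × Certificate => ∀ mv ∈ moves p.2.2.1.1.1,
      (p.2.2.1.1.ampCode p.2.2.2.2.2 (precision p.2.2.1 p.2.2.2) p.2.1 p.1 mv).isSome = true :=
    h.forall_mem_list_comp hmv
  have h2 : PrimrecPred fun p : ℕ × Input × Certificate =>
      ∀ a ∈ (Finset.univ : Finset Symb).toList, ∀ mv ∈ moves p.2.1.1.1,
      (p.2.1.1.ampCode p.2.2.2.2 (precision p.2.1 p.2.2) p.1 a mv).isSome = true :=
    h1.forall_mem_list_comp (.const (Finset.univ : Finset Symb).toList)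
  have hk : Primrec fun p : Input × Certificate => p.1.1.1 := .comp .fst (.comp .fst .fst)
  have h3 : PrimrecPred fun p : Input × Certificate => Fueled p.1 p.2 :=
    h2.forall_lt_comp hk
  exact PrimrecPred.primrecRel h3

theorem primrecRel_nearlyDiagonal : PrimrecRel NearlyDiagonal := by
  have i : Primrec fun p : ℕ × ℕ × Input × Certificate => p.2.1 := .comp .fst .snd
  have j : Primrec fun p : ℕ × ℕ × Input × Certificate => p.1 := .fst
  have x : Primrec fun p : ℕ × ℕ × Input × Certificate => p.2.2.1 := .comp .fst (.comp .snd .snd)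
  have c : Primrec fun p : ℕ × ℕ × Input × Certificate => p.2.2.2 := .comp .snd (.comp .snd .snd)
  have init {i : ℕ × ℕ × Input × Certificate → ℕ} (hi : Primrec i) : Primrec fun p : ℕ × ℕ × Input × Certificate =>
      initTerms p.2.2.1.1.2.1 p.2.2.1.2.1 p.2.2.1.2.2.1 (p.2.2.2.vec (i p)) :=
    primrec_initTerms_comp (.comp .fst (.comp .snd (.comp .fst x))) (.comp .fst (.comp .snd x))
      (.comp .fst (.comp .snd (.comp .snd x))) (primrec_vec.comp c hi)
  have eq : PrimrecPred fun p : ℕ × ℕ × Input × Certificate => p.2.1 = p.1 := Primrec.eq.comp i j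
  have delta : Primrec fun p : ℕ × ℕ × Input × Certificate => if p.2.1 = p.1 then 1 else 0 :=
    Primrec.ite eq (.const 1) (.const 0)
  have e : Primrec fun p : ℕ × ℕ × Input × Certificate => entry p.2.2.1 p.2.2.2 p.2.1 p.1 := primrec_entry x c i j
  have tol : Primrec fun p : ℕ × ℕ × Input × Certificate => tolerance p.2.2.1 p.2.2.2 := primrec_tolerance.comp x c
  have len : PrimrecPred fun p : ℕ × ℕ × Input × Certificate => p.2.2.2.1.1.length ≤ p.2.1 :=
    Primrec.nat_le.comp (Primrec.list_length.comp (.comp .fst (.comp .fst c))) i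
  have diag : PrimrecPred fun p : ℕ × ℕ × Input × Certificate => p.2.1 = p.1 ∧ p.2.2.2.1.1.length ≤ p.2.1 := eq.and len
  have gap : Primrec fun p : ℕ × ℕ × Input × Certificate => p.2.2.2.2.1 := .comp .fst (.comp .snd c)
  have g : Primrec fun p : ℕ × ℕ × Input × Certificate =>
      (gram (initTerms p.2.2.1.1.2.1 p.2.2.1.2.1 p.2.2.1.2.2.1 (p.2.2.2.vec p.2.1))
        (initTerms p.2.2.1.1.2.1 p.2.2.1.2.1 p.2.2.1.2.2.1 (p.2.2.2.vec p.1))).add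
        (GaussCode.ofNat (if p.2.1 = p.1 then 1 else 0)).neg :=
    GaussCode.primrec_add.comp (primrec_gram.comp (init i) (init j))
      (GaussCode.primrec_neg.comp (GaussCode.primrec_ofNat.comp delta))
  have h1 : PrimrecPred fun p : ℕ × ℕ × Input × Certificate => GaussCode.Small (tolerance p.2.2.1 p.2.2.2)
      ((gram (initTerms p.2.2.1.1.2.1 p.2.2.1.2.1 p.2.2.1.2.2.1 (p.2.2.2.vec p.2.1))
        (initTerms p.2.2.1.1.2.1 p.2.2.1.2.1 p.2.2.1.2.2.1 (p.2.2.2.vec p.1))).add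
        (GaussCode.ofNat (if p.2.1 = p.1 then 1 else 0)).neg) :=
    GaussCode.primrecRel_small.comp tol g
  have hgap : PrimrecPred fun p : ℕ × ℕ × Input × Certificate =>
      GaussCode.Small p.2.2.2.2.1 (entry p.2.2.1 p.2.2.2 p.2.1 p.1) :=
    GaussCode.primrecRel_small.comp gap e
  have htol : PrimrecPred fun p : ℕ × ℕ × Input × Certificate =>
      GaussCode.Small (tolerance p.2.2.1 p.2.2.2) (entry p.2.2.1 p.2.2.2 p.2.1 p.1) :=
    GaussCode.primrecRel_small.comp tol e
  have h2 : PrimrecPred fun p : ℕ × ℕ × Input × Certificate => if p.2.1 = p.1 ∧ p.2.2.2.1.1.length ≤ p.2.1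
      then ¬ (entry p.2.2.1 p.2.2.2 p.2.1 p.1).Small p.2.2.2.2.1
      else (entry p.2.2.1 p.2.2.2 p.2.1 p.1).Small (tolerance p.2.2.1 p.2.2.2) := 
    diag.ite_prop hgap.not htol
  have N : Primrec fun p : Input × Certificate => 2 ^ p.1.2.1 :=
    primrec_nat_pow.comp (.const 2) (.comp .fst (.comp .snd .fst))
  have N' : Primrec fun p : ℕ × Input × Certificate => 2 ^ p.2.1.2.1 := N.comp .snd
  have h3 : PrimrecPred fun p : ℕ × Input × Certificate => ∀ j < 2 ^ p.2.1.2.1,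
      GaussCode.Small (tolerance p.2.1 p.2.2)
        ((gram (initTerms p.2.1.1.2.1 p.2.1.2.1 p.2.1.2.2.1 (p.2.2.vec p.1))
          (initTerms p.2.1.1.2.1 p.2.1.2.1 p.2.1.2.2.1 (p.2.2.vec j))).add
          (GaussCode.ofNat (if p.1 = j then 1 else 0)).neg) ∧
      (if p.1 = j ∧ p.2.2.1.1.length ≤ p.1 then ¬ (entry p.2.1 p.2.2 p.1 j).Small p.2.2.2.1
        else (entry p.2.1 p.2.2 p.1 j).Small (tolerance p.2.1 p.2.2)) :=
    (h1.and h2).forall_lt_comp N'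
  have h4 : PrimrecPred fun p : Input × Certificate => NearlyDiagonal p.1 p.2 :=
    h3.forall_lt_comp N
  exact PrimrecPred.primrecRel h4

theorem primrecRel_accepts : PrimrecRel Accepts := by
  have c : Primrec fun p : Input × Certificate => p.2.1 := .comp .fst .snd
  have N : Primrec fun p : Input × Certificate => 2 ^ p.1.2.1 :=
    primrec_nat_pow.comp (.const 2) (.comp .fst (.comp .snd .fst))
  have h1 : PrimrecPred fun p : Input × Certificate =>
      (p.2.1.1 ++ p.2.1.2).length = 2 ^ p.1.2.1 :=
    Primrec.eq.comp (Primrec.list_length.comp (Primrec.list_append.comp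
      (.comp .fst c) (.comp .snd c))) N
  have h2 : PrimrecPred fun p : Input × Certificate => 0 < p.2.2.1 :=
    Primrec.nat_lt.comp (.const 0) (.comp .fst (.comp .snd .snd))
  have h3 : PrimrecPred fun p : Input × Certificate => Fueled p.1 p.2 := primrecRel_fueled
  have h4 : PrimrecPred fun p : Input × Certificate => NearlyDiagonal p.1 p.2 :=
    primrecRel_nearlyDiagonal
  have h : PrimrecPred fun p : Input × Certificate => Accepts p.1 p.2 :=
    (h1.and h2).and (h3.and h4)
  exact PrimrecPred.primrecRel h

theorem primrec_output : Primrec₂ output := by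
  have t : Primrec fun p : Input × Certificate => p.1.2.2.1 + 1 :=
    Primrec.succ.comp (.comp .fst (.comp .snd (.comp .snd .fst)))
  have g : Primrec fun p : Input × Certificate => p.2.2.1 := .comp .fst (.comp .snd .snd)
  have d : Primrec fun p : Input × Certificate => p.1.2.2.2.2 ^ 2 :=
    primrec_nat_pow.comp (.comp .snd (.comp .snd (.comp .snd (.comp .snd .fst)))) (.const 2)
  have c : Primrec fun _ : Input × Certificate => 8 := .const 8
  have L : Primrec fun p : Input × Certificate => p.2.1.1 := .comp .fst (.comp .fst .snd)
  exact Primrec₂.mk (.pair L (.pair (.const 1)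
    (Primrec.nat_mul.comp (Primrec.nat_mul.comp (Primrec.nat_mul.comp c t) g) d)))

theorem partrec_search : Partrec search := by
  classical
  have x : Primrec fun p : (Input × ℕ) × Certificate => p.1.1 := .comp .fst .fst
  have h1 : PrimrecPred fun p : (Input × ℕ) × Certificate => Accepts p.1.1 p.2 :=
    primrecRel_accepts.comp x .snd
  have h2 : Primrec fun p : (Input × ℕ) × Certificate => some (output p.1.1 p.2) :=
    Primrec.option_some.comp (primrec_output.comp x .snd)
  have h3 : Primrec fun p : (Input × ℕ) × Certificate =>
      if Accepts p.1.1 p.2 then some (output p.1.1 p.2) else none :=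
    Primrec.ite h1 h2 (.const none)
  have h4 : Primrec fun p : Input × ℕ => (Encodable.decode p.2 : Option Certificate).bind fun c =>
      if Accepts p.1 c then some (output p.1 c) else none :=
    Primrec.option_bind (Primrec.decode.comp .snd) (Primrec₂.mk h3)
  exact (Partrec.rfindOpt (Primrec.to_comp h4).to₂).of_eq fun x => by
    unfold search
    congr! 3

end QTMCode

/-! ### The Hilbert space of a machine -/

namespace QTuring

variable {k : ℕ}

open Classical in
theorem ket_apply (c c' : Config k) : ket c c' = if c' = c then 1 else 0 := by
  unfold ket
  rw [lp.single_apply]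
  split_ifs with h
  · subst h; exact Pi.single_eq_same _ _
  · exact Pi.single_eq_of_ne h _

theorem inner_ket_left (c : Config k) (f : MachineSpace k) : inner ℂ (ket c) f = f c := by
  classical
  unfold ket
  rw [show (lp.single 2 c (1 : ℂ) : MachineSpace k) = lp.single 2 c (1 : ℂ) by congr!,
    lp.inner_single_left]
  simp

theorem inner_ket_right (c : Config k) (f : MachineSpace k) :
    inner ℂ f (ket c) = (starRingEnd ℂ) (f c) := by
  rw [← inner_conj_symm, inner_ket_left]

open Classical in
theorem inner_ket_ket (c c' : Config k) :
    inner ℂ (ket c) (ket c') = if c = c' then (1 : ℂ) else 0 := by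
  rw [inner_ket_left, ket_apply]

theorem norm_ket (c : Config k) : ‖ket c‖ = 1 := by
  have h := inner_self_eq_norm_sq_to_K (𝕜 := ℂ) (ket c)
  rw [inner_ket_ket, if_pos rfl] at h
  have h2 : ‖ket c‖ ^ 2 = 1 := Complex.ofReal_injective (by push_cast; exact h.symm)
  nlinarith [norm_nonneg (ket c)]

/-- The projection onto the configurations with control state `q`. -/
noncomputable def stateProj (q : Fin k) : MachineSpace k →L[ℂ] MachineSpace k :=
  LinearMap.mkContinuous
    { toFun := fun f => ⟨fun c => if c.1 = q then f c else 0,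
        (lp.memℓp f).mono' fun c => by split_ifs <;> simp⟩
      map_add' := fun f g => by
        ext c
        change (if c.1 = q then f c + g c else 0) =
          (if c.1 = q then f c else 0) + if c.1 = q then g c else 0
        split_ifs <;> simp
      map_smul' := fun a f => by
        ext c
        change (if c.1 = q then a * f c else 0) = a * if c.1 = q then f c else 0
        split_ifs <;> simp } 1 fun f => by
    rw [one_mul]
    refine lp.norm_mono (by simp) fun c => ?_
    change ‖if c.1 = q then f c else 0‖ ≤ ‖f c‖
    split_ifs <;> simp

theorem stateProj_apply (q : Fin k) (f : MachineSpace k) (c : Config k) :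
    stateProj q f c = if c.1 = q then f c else 0 := rfl

theorem norm_stateProj_le (q : Fin k) (f : MachineSpace k) : ‖stateProj q f‖ ≤ ‖f‖ := by
  refine (ContinuousLinearMap.le_of_opNorm_le _ (LinearMap.mkContinuous_norm_le _ zero_le_one _) f).trans ?_
  rw [one_mul]

theorem stateProj_ket (q : Fin k) (c : Config k) :
    stateProj q (ket c) = if c.1 = q then ket c else 0 := by
  ext c'
  rw [stateProj_apply]
  by_cases h : c' = c
  · subst h; split_ifs <;> rfl
  · rw [ket_apply, if_neg h, ite_self]
    split_ifs
    · rw [ket_apply, if_neg h]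
    · rfl

theorem inner_stateProj_left (q : Fin k) (f g : MachineSpace k) :
    inner ℂ (stateProj q f) g = inner ℂ (stateProj q f) (stateProj q g) := by
  rw [lp.inner_eq_tsum, lp.inner_eq_tsum]
  refine tsum_congr fun c => ?_
  simp only [stateProj_apply]
  split_ifs <;> simp

theorem norm_sub_stateProj_sq (q : Fin k) (f : MachineSpace k) :
    ‖f - stateProj q f‖ ^ 2 = ‖f‖ ^ 2 - ‖stateProj q f‖ ^ 2 := by
  have h : RCLike.re (inner ℂ f (stateProj q f)) = ‖stateProj q f‖ ^ 2 := by
    rw [inner_re_symm, inner_stateProj_left, inner_self_eq_norm_sq]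
  rw [norm_sub_sq (𝕜 := ℂ), h]
  ring

/-- The configuration after writing `a`, entering `q` and moving the head in direction `d`. -/
noncomputable def Config.next (c : Config k) (a : Symb) (q : Fin k) (d : Bool) : Config k :=
  (q, c.2.1.write c.2.2 a, c.2.2 + shift d)

/-- The written symbol can be read off at the old head position, and the direction from the
displacement of the head. -/
theorem Config.next_inj {c : Config k} {a a' : Symb} {q q' : Fin k} {d d' : Bool}
    (h : Config.next c a q d = Config.next c a' q' d') : a = a' ∧ q = q' ∧ d = d' := by
  simp only [Config.next, Prod.mk.injEq] at h
  obtain ⟨hq, ht, hd⟩ := h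
  refine ⟨?_, hq, ?_⟩
  · have := congrArg (fun x : Tape => x.1 c.2.2) ht
    simpa [Tape.write] using this
  · cases d <;> cases d' <;> simp [shift] at hd ⊢

/-- By `Config.next_inj` the summands of `stepKet` are distinct basis vectors up to scalars, so each
amplitude is a coordinate of the image of a basis vector. -/
theorem stepKet_next (amp : Transition k) (c : Config k) (a : Symb) (q : Fin k) (d : Bool) :
    stepKet amp c (Config.next c a q d) = amp c.1 (c.2.1.1 c.2.2) a q d := by
  classical
  rw [← inner_ket_left, stepKet]
  simp only [inner_sum, inner_smul_right]
  have key : ∀ a' q' d', ¬ (a = a' ∧ q = q' ∧ d = d') → inner ℂ (ket (Config.next c a q d))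
      (ket (q', c.2.1.write c.2.2 a', c.2.2 + shift d')) = (0 : ℂ) := fun a' q' d' h => by
    rw [inner_ket_ket]
    exact if_neg fun h' => h (Config.next_inj h')
  rw [Finset.sum_eq_single a, Finset.sum_eq_single q, Finset.sum_eq_single d]
  · have : inner ℂ (ket (Config.next c a q d)) (ket (q, c.2.1.write c.2.2 a, c.2.2 + shift d))
      = (1 : ℂ) := by rw [inner_ket_ket]; exact if_pos rfl
    rw [this, mul_one]
  · intro d' _ h
    rw [key _ _ _ fun h' => h h'.2.2.symm, mul_zero]
  · simp
  · intro q' _ h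
    refine Finset.sum_eq_zero fun d' _ => ?_
    rw [key _ _ _ fun h' => h h'.2.1.symm, mul_zero]
  · simp
  · intro a' _ h
    refine Finset.sum_eq_zero fun q' _ => Finset.sum_eq_zero fun d' _ => ?_
    rw [key _ _ _ fun h' => h h'.1.symm, mul_zero]
  · simp

end QTuring

/-! ### Halting probabilities and the deviation operator -/

namespace QTM

open QTuring

theorem evol_ket (M : QTM) (c : Config M.numStates) : M.evol (ket c) = stepKet M.amp c :=
  M.unitary_evolution.choose_spec.2 c

theorem adjoint_evol_comp_evol (M : QTM) : star M.evol * M.evol = 1 :=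
  Unitary.star_mul_self_of_mem M.unitary_evolution.choose_spec.1

theorem norm_evol_apply (M : QTM) (x : MachineSpace M.numStates) : ‖M.evol x‖ = ‖x‖ :=
  M.evol.norm_map_iff_adjoint_comp_self.2 M.adjoint_evol_comp_evol x

theorem norm_evol_pow_apply (M : QTM) (t : ℕ) (x : MachineSpace M.numStates) :
    ‖(M.evol ^ t) x‖ = ‖x‖ := by
  induction t with
  | zero => rfl
  | succ t ih => rw [pow_succ', mul_apply_eq_comp, norm_evol_apply, ih]

/-- An amplitude is a coordinate of the image of a unit vector under an isometry. This is the bound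
that controls the growth of coefficients in the simulation. -/
theorem norm_amp_le (M : QTM) (q : Fin M.numStates) (a a' : Symb) (q' : Fin M.numStates)
    (d : Bool) : ‖M.amp q a a' q' d‖ ≤ 1 := by
  let c : Config M.numStates := (q, ⟨Function.update (fun _ => blank) 0 a,
    (Set.finite_singleton 0).subset fun i hi => by_contra fun h => hi (Function.update_of_ne h _ _)⟩, 0)
  have h := stepKet_next M.amp c a' q' d
  have h2 : c.2.1.1 c.2.2 = a := by simp [c]
  rw [h2, ← evol_ket] at h
  rw [show M.amp q a a' q' d = _ from h.symm]
  refine (lp.norm_apply_le_norm (by simp) _ _).trans ?_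
  rw [norm_evol_apply, norm_ket]

theorem Tape.input_injective {n : ℕ} : Function.Injective (Tape.input (n := n)) := by
  intro s s' h
  funext i
  have := congrArg (fun x : Tape => x.1 (i : ℤ)) h
  simpa [Tape.input] using this

theorem embed_apply (M : QTM) {n : ℕ} (ψ : Qubits n) :
    M.embed n ψ = ∑ s, ψ s • ket ((M.q0, Tape.input s, 0) : Config M.numStates) := by
  simp [embed]

theorem inner_embed (M : QTM) {n : ℕ} (φ ψ : Qubits n) :
    inner ℂ (M.embed n φ) (M.embed n ψ) = inner ℂ φ ψ := by
  classical
  rw [embed_apply, embed_apply, sum_inner, PiLp.inner_apply]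
  refine Finset.sum_congr rfl fun s _ => ?_
  rw [inner_sum, Finset.sum_eq_single s]
  · rw [inner_smul_left, inner_smul_right, inner_ket_ket, if_pos rfl, RCLike.inner_apply]
    ring
  · intro s' _ hs
    rw [inner_smul_left, inner_smul_right, inner_ket_ket, if_neg, mul_zero, mul_zero]
    intro h
    simp only [Prod.mk.injEq, true_and, and_true] at h
    exact hs (Tape.input_injective h).symm
  · simp

theorem norm_embed (M : QTM) {n : ℕ} (ψ : Qubits n) : ‖M.embed n ψ‖ = ‖ψ‖ := by
  rw [@norm_eq_sqrt_re_inner ℂ, inner_embed, ← @norm_eq_sqrt_re_inner ℂ]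

/-- The component with control in the final state at time `t` of the evolution of an input. -/
noncomputable def haltOp (M : QTM) (n t : ℕ) : Qubits n →L[ℂ] MachineSpace M.numStates :=
  stateProj M.qf ∘L (M.evol ^ t) ∘L M.embed n

theorem haltOp_apply (M : QTM) {n : ℕ} (t : ℕ) (ψ : Qubits n) :
    M.haltOp n t ψ = stateProj M.qf ((M.evol ^ t) (M.embed n ψ)) := rfl

theorem norm_haltOp_le (M : QTM) {n : ℕ} (t : ℕ) (ψ : Qubits n) : ‖M.haltOp n t ψ‖ ≤ ‖ψ‖ := by
  refine (norm_stateProj_le _ _).trans ?_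
  change ‖(M.evol ^ t) (M.embed n ψ)‖ ≤ _
  rw [norm_evol_pow_apply, norm_embed]

theorem globalState_rankOne (M : QTM) {n : ℕ} (t : ℕ) (ψ : Qubits n)
    (x : MachineSpace M.numStates) :
    M.globalState t (InnerProductSpace.rankOne ℂ ψ ψ) x =
      inner ℂ ((M.evol ^ t) (M.embed n ψ)) x • (M.evol ^ t) (M.embed n ψ) := by
  have h : (ContinuousLinearMap.adjoint M.evol) ^ t = ContinuousLinearMap.adjoint (M.evol ^ t) := by
    rw [← ContinuousLinearMap.star_eq_adjoint, ← ContinuousLinearMap.star_eq_adjoint, star_pow]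
  simp only [globalState, h, ContinuousLinearMap.comp_apply, InnerProductSpace.rankOne_apply,
    map_smul, ContinuousLinearMap.adjoint_inner_right]

/-- The global state is the rank one operator of the evolved vector `Ψ`, so the diagonal entry of
the partial trace at `q_f` is the sum of `|Ψ(q_f, y)|²` over all `y`. -/
theorem haltOverlap_eq (M : QTM) {n : ℕ} (t : ℕ) (ψ : Qubits n) :
    M.haltOverlap t ψ = ‖M.haltOp n t ψ‖ ^ 2 := by
  set Ψ := (M.evol ^ t) (M.embed n ψ) with hΨ
  have h : M.controlState t (InnerProductSpace.rankOne ℂ ψ ψ) M.qf M.qf =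
      inner ℂ (M.haltOp n t ψ) (M.haltOp n t ψ) := by
    rw [lp.inner_eq_tsum]
    have hinj : Function.Injective (fun y : Tape × ℤ => ((M.qf, y) : Config M.numStates)) :=
      fun y y' h => by simpa using h
    rw [← hinj.tsum_eq]
    · refine tsum_congr fun y => ?_
      rw [globalState_rankOne, inner_ket_left, haltOp_apply, stateProj_apply, if_pos rfl]
      simp only [lp.coeFn_smul, Pi.smul_apply, inner_ket_right, ← hΨ, RCLike.inner_apply, smul_eq_mul]
      ring
    · intro c hc
      by_cases h : c.1 = M.qf
      · exact ⟨c.2, by rw [← h]⟩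
      · refine absurd ?_ hc
        have h0 : M.haltOp n t ψ c = 0 := by rw [haltOp_apply, stateProj_apply, if_neg h]
        change inner ℂ (M.haltOp n t ψ c) (M.haltOp n t ψ c) = (0 : ℂ)
        rw [h0, inner_zero_left]
  rw [haltOverlap, h]
  exact inner_self_eq_norm_sq (𝕜 := ℂ) _

/-- The operator whose quadratic form measures the deviation from halting at time `t`. -/
noncomputable def defectOp (M : QTM) (n t : ℕ) : Qubits n →L[ℂ] Qubits n :=
  1 - ContinuousLinearMap.adjoint (M.haltOp n t) ∘L M.haltOp n t +
    ∑ τ ∈ Finset.range t, ContinuousLinearMap.adjoint (M.haltOp n τ) ∘L M.haltOp n τ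

theorem inner_defectOp (M : QTM) {n : ℕ} (t : ℕ) (φ ψ : Qubits n) :
    inner ℂ φ (M.defectOp n t ψ) = inner ℂ φ ψ - inner ℂ (M.haltOp n t φ) (M.haltOp n t ψ) +
      ∑ τ ∈ Finset.range t, inner ℂ (M.haltOp n τ φ) (M.haltOp n τ ψ) := by
  simp [defectOp, ContinuousLinearMap.adjoint_inner_right]

theorem isSymmetric_defectOp (M : QTM) (n t : ℕ) :
    (M.defectOp n t : Qubits n →ₗ[ℂ] Qubits n).IsSymmetric := by
  intro φ ψ
  change inner ℂ (M.defectOp n t φ) ψ = inner ℂ φ (M.defectOp n t ψ)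
  rw [← inner_conj_symm, inner_defectOp, inner_defectOp]
  simp

/-- On a unit vector `1 - p_t` and all `p_τ` are nonnegative, so a bound on this one number bounds
each of them. This is why a single operator can encode all the halting conditions. -/
theorem re_inner_defectOp (M : QTM) {n : ℕ} (t : ℕ) (ψ : Qubits n) :
    (inner ℂ ψ (M.defectOp n t ψ)).re = ‖ψ‖ ^ 2 - M.haltOverlap t ψ +
      ∑ τ ∈ Finset.range t, M.haltOverlap τ ψ := by
  have h (E : Type) [NormedAddCommGroup E] [InnerProductSpace ℂ E] (x : E) :
    (inner ℂ x x).re = ‖x‖ ^ 2 := inner_self_eq_norm_sq (𝕜 := ℂ) x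
  simp only [inner_defectOp, Complex.add_re, Complex.sub_re, Complex.re_sum, h, haltOverlap_eq]

theorem haltOverlap_nonneg (M : QTM) {n : ℕ} (t : ℕ) (ψ : Qubits n) : 0 ≤ M.haltOverlap t ψ := by
  rw [haltOverlap_eq]; positivity

theorem haltOverlap_le (M : QTM) {n : ℕ} (t : ℕ) (ψ : Qubits n) :
    M.haltOverlap t ψ ≤ ‖ψ‖ ^ 2 := by
  rw [haltOverlap_eq]
  exact pow_le_pow_left₀ (norm_nonneg _) (M.norm_haltOp_le t ψ) 2

theorem re_inner_defectOp_nonneg (M : QTM) {n : ℕ} (t : ℕ) (ψ : Qubits n) :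
    0 ≤ (inner ℂ ψ (M.defectOp n t ψ)).re := by
  rw [re_inner_defectOp]
  have := Finset.sum_nonneg fun τ (_ : τ ∈ Finset.range t) => M.haltOverlap_nonneg τ ψ
  linarith [M.haltOverlap_le t ψ]

theorem isEpsHalting_of_re_inner_defectOp_le (M : QTM) {n t : ℕ} {ε : ℝ} {ψ : Qubits n}
    (hψ : ‖ψ‖ = 1) (h : (inner ℂ ψ (M.defectOp n t ψ)).re ≤ ε) : M.IsEpsHalting ε t ψ := by
  rw [re_inner_defectOp, hψ] at h
  have h1 := M.haltOverlap_le t ψ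
  rw [hψ] at h1
  have h2 := Finset.sum_nonneg fun τ (_ : τ ∈ Finset.range t) => M.haltOverlap_nonneg τ ψ
  refine ⟨hψ, by linarith, fun τ hτ => ?_⟩
  have h3 := Finset.single_le_sum (fun τ (_ : τ ∈ Finset.range t) => M.haltOverlap_nonneg τ ψ)
    (Finset.mem_range.2 hτ)
  linarith

/-- Each of the `t + 1` nonnegative terms of the form contributes at most `ε`; this is the origin of
the factor `t + 1` in the accuracy. -/
theorem IsEpsHalting.re_inner_defectOp_le {M : QTM} {n t : ℕ} {ε : ℝ} {ψ : Qubits n}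
    (h : M.IsEpsHalting ε t ψ) : (inner ℂ ψ (M.defectOp n t ψ)).re ≤ (t + 1) * ε := by
  rw [re_inner_defectOp, h.1]
  have h2 := Finset.sum_le_card_nsmul (Finset.range t) (fun τ => M.haltOverlap τ ψ) ε
    fun τ hτ => h.2.2 τ (Finset.mem_range.1 hτ)
  rw [Finset.card_range, nsmul_eq_mul] at h2
  linarith [h.2.1]

theorem IsHalting.isEpsHalting {M : QTM} {n t : ℕ} {ψ : Qubits n} (h : M.IsHalting t ψ) :
    M.IsEpsHalting 0 t ψ :=
  ⟨h.1, by rw [h.2.1, sub_zero], fun τ hτ => (h.2.2 τ hτ).le⟩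

/-- Vectors that halt approximately at different times are almost orthogonal. -/
theorem IsEpsHalting.norm_inner_le {M : QTM} {n t t' : ℕ} {ε : ℝ} {φ ψ : Qubits n}
    (hφ : M.IsEpsHalting ε t φ) (hψ : M.IsEpsHalting ε t' ψ) (h : t < t') :
    ‖(inner ℂ φ ψ : ℂ)‖ ≤ 2 * Real.sqrt ε := by
  set Φ := (M.evol ^ t) (M.embed n φ)
  set Ψ := (M.evol ^ t) (M.embed n ψ)
  have h0 : inner ℂ φ ψ = inner ℂ Φ Ψ := by
    rw [← M.inner_embed, (LinearMap.norm_map_iff_inner_map_map (𝕜 := ℂ) (M.evol ^ t)).1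
      (M.norm_evol_pow_apply t)]
  -- At the earlier time `t` the evolved `φ` is split by the projection onto `q_f`. The projected
  -- part meets only the projected part of `Ψ`, which is small because `ψ` has not halted yet; the
  -- remainder is small because `φ` halts at time `t`.
  have h1 : inner ℂ φ ψ = inner ℂ (M.haltOp n t φ) (M.haltOp n t ψ) +
      inner ℂ (Φ - stateProj M.qf Φ) Ψ := by
    rw [h0, inner_sub_left, haltOp_apply, haltOp_apply, ← inner_stateProj_left]
    ring
  have hΦ : ‖Φ‖ = 1 := by rw [norm_evol_pow_apply, norm_embed, hφ.1]
  have hΨ : ‖Ψ‖ = 1 := by rw [norm_evol_pow_apply, norm_embed, hψ.1]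
  have h2 : ‖M.haltOp n t ψ‖ ≤ Real.sqrt ε := by
    refine Real.le_sqrt_of_sq_le ?_
    rw [← haltOverlap_eq]
    exact hψ.2.2 t h
  have h3 : ‖Φ - stateProj M.qf Φ‖ ≤ Real.sqrt ε := by
    refine Real.le_sqrt_of_sq_le ?_
    have h4 := hφ.2.1
    rw [haltOverlap_eq, haltOp_apply] at h4
    rw [norm_sub_stateProj_sq, hΦ]
    linarith
  have h5 : ‖M.haltOp n t φ‖ ≤ 1 := (M.norm_haltOp_le t φ).trans_eq hφ.1
  rw [h1]
  calc _ ≤ ‖M.haltOp n t φ‖ * ‖M.haltOp n t ψ‖ + ‖Φ - stateProj M.qf Φ‖ * ‖Ψ‖ :=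
        (norm_add_le _ _).trans (add_le_add (norm_inner_le_norm _ _) (norm_inner_le_norm _ _))
    _ ≤ 1 * Real.sqrt ε + Real.sqrt ε * 1 := by rw [hΨ]; gcongr
    _ = _ := by ring

end QTM

/-! ### Semantics of the simulation -/

namespace QTuring

/-- The tape with a finite window whose cell `0` is the cell with number `T` of the window. -/
def windowTape (T : ℕ) (l : List Symb) : Tape :=
  ⟨fun i => if 0 ≤ i + T then l.getD (i + T).toNat blank else blank,
    (Set.finite_Ico (-T : ℤ) l.length).subset fun i hi => by
      by_cases h : 0 ≤ i + T
      · refine ⟨by omega, ?_⟩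
        by_contra h2
        refine hi ?_
        simp only [h, if_true]
        exact List.getD_eq_default _ _ (by omega)
      · exact absurd (if_neg h) hi⟩

theorem windowTape_apply (T : ℕ) (l : List Symb) (j : ℕ) :
    (windowTape T l).1 ((j : ℤ) - T) = l.getD j blank := by
  simp [windowTape]

theorem windowTape_injective {T : ℕ} {l l' : List Symb} (hl : l.length = l'.length)
    (h : windowTape T l = windowTape T l') : l = l' := by
  refine List.ext_getElem hl fun j h1 h2 => ?_
  have := congrArg (fun x : Tape => x.1 ((j : ℤ) - T)) h
  simpa only [windowTape_apply, List.getD_eq_getElem _ _ h1, List.getD_eq_getElem _ _ h2] using this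

theorem windowTape_set {T : ℕ} {l : List Symb} {j : ℕ} (hj : j < l.length) (a : Symb) :
    windowTape T (l.set j a) = (windowTape T l).write ((j : ℤ) - T) a := by
  refine Subtype.ext (funext fun i => ?_)
  simp only [windowTape, Tape.write]
  by_cases h : i = (j : ℤ) - T
  · subst h
    simp [hj]
  · rw [Function.update_of_ne h]
    split_ifs with h2
    · have : j ≠ (i + T).toNat := by omega
      simp [List.getD_eq_getElem?_getD, List.getElem?_set_ne this]
    · rfl

theorem windowTape_inputWindow {n : ℕ} (T j : ℕ) (s : Fin n → Bool)
    (h : ∀ i : Fin n, decide (j / 2 ^ (i : ℕ) % 2 = 1) = s i) :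
    windowTape T (inputWindow n T j) = Tape.input s := by
  refine Subtype.ext (funext fun i => ?_)
  have hget (m : ℕ) : (inputWindow n T j).getD m blank = if T ≤ m ∧ m < T + n then
      (some (decide (j / 2 ^ (m - T) % 2 = 1)), none) else blank := by
    by_cases hm : m < n + 2 * T
    · rw [List.getD_eq_getElem _ _ (by simpa [inputWindow] using hm)]
      simp [inputWindow]
    · rw [List.getD_eq_default _ _ (by simpa [inputWindow] using hm), if_neg (by omega)]
  simp only [windowTape, Tape.input, hget]
  by_cases h1 : 0 ≤ i ∧ i.toNat < n
  · rw [if_pos (by omega), if_pos (by omega), dif_pos h1, ← h ⟨i.toNat, h1.2⟩]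
    have : (i + T).toNat - T = i.toNat := by omega
    rw [this]
  · rw [dif_neg h1]
    split_ifs with h2 h3
    · omega
    · rfl
    · rfl

/-- The code of a configuration is valid for a machine with `k` states, the window has length
`len`, and the head has distance at least `r` from its ends. -/
def ConfCode.Valid (k len r : ℕ) (c : ConfCode) : Prop :=
  c.1 < k ∧ c.2.1.length = len ∧ r ≤ c.2.2 ∧ c.2.2 + r ≤ len

/-- A step moves the head by one cell and thus uses up at most one cell of the margin. -/
theorem ConfCode.Valid.move {k len r : ℕ} {c : ConfCode} (h : c.Valid k len (r + 1)) {mv : Move}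
    (hmv : mv.2.1 < k) : (c.move mv).Valid k len r := by
  obtain ⟨h1, h2, h3, h4⟩ := h
  refine ⟨hmv, by simpa [ConfCode.move] using h2, ?_, ?_⟩ <;>
  · simp only [ConfCode.move]
    split_ifs <;> omega

/-- The configuration with the given code. -/
def ConfCode.config {k : ℕ} (q0 : Fin k) (T : ℕ) (c : ConfCode) : Config k :=
  (⟨c.1 % k, Nat.mod_lt _ (Fin.pos q0)⟩, windowTape T c.2.1, (c.2.2 : ℤ) - T)

variable {k : ℕ} {q0 : Fin k} {T len r : ℕ}

/-- Validity makes the reduction modulo `k` trivial, and equal window lengths rule out windows that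
differ only by blanks at the end. -/
theorem ConfCode.config_injective {c c' : ConfCode} (h : c.Valid k len r) (h' : c'.Valid k len r)
    (heq : c.config q0 T = c'.config q0 T) : c = c' := by
  simp only [ConfCode.config, Prod.mk.injEq, Fin.mk.injEq, Nat.mod_eq_of_lt h.1,
    Nat.mod_eq_of_lt h'.1] at heq
  exact Prod.ext heq.1 (Prod.ext
    (windowTape_injective (h.2.1.trans h'.2.1.symm) heq.2.1) (by have := heq.2.2; omega))

theorem ConfCode.config_read (c : ConfCode) :
    (c.config q0 T).2.1.1 (c.config q0 T).2.2 = c.read := windowTape_apply _ _ _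

/-- A margin of at least one puts the written cell inside the window and keeps the subtraction in a
move to the left from being truncated. -/
theorem ConfCode.config_move {c : ConfCode} (h : c.Valid k len (r + 1)) (a : Symb) (q : Fin k)
    (d : Bool) : (c.move (a, q, d)).config q0 T = Config.next (c.config q0 T) a q d := by
  obtain ⟨h1, h2, h3, h4⟩ := h
  refine Prod.ext (Fin.ext (Nat.mod_eq_of_lt q.2)) (Prod.ext ?_ ?_)
  · exact windowTape_set (by omega) a
  · cases d <;> simp [ConfCode.config, ConfCode.move, Config.next, shift] <;> omega

/-- The vector that a list of weighted configurations represents. -/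
noncomputable def toVec (q0 : Fin k) (T : ℕ) (l : Terms) : MachineSpace k :=
  (l.map fun x => x.2.val • ket (x.1.config q0 T)).sum

/-- The sum of the absolute values of the coefficients. -/
noncomputable def weight (l : Terms) : ℝ := (l.map fun x => ‖x.2.val‖).sum

theorem toVec_cons (x : ConfCode × GaussCode) (l : Terms) :
    toVec q0 T (x :: l) = x.2.val • ket (x.1.config q0 T) + toVec q0 T l := by
  simp [toVec]

theorem toVec_append (l l' : Terms) : toVec q0 T (l ++ l') = toVec q0 T l + toVec q0 T l' := by
  simp [toVec]

theorem weight_cons (x : ConfCode × GaussCode) (l : Terms) :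
    weight (x :: l) = ‖x.2.val‖ + weight l := by
  simp [weight]

theorem weight_append (l l' : Terms) : weight (l ++ l') = weight l + weight l' := by
  simp [weight]

theorem weight_nonneg (l : Terms) : 0 ≤ weight l :=
  List.sum_nonneg fun _ h => by
    obtain ⟨x, _, rfl⟩ := List.mem_map.1 h
    exact norm_nonneg _

theorem mem_moves {mv : Move} : mv ∈ moves k ↔ mv.2.1 < k := by
  obtain ⟨a, q, d⟩ := mv
  cases d <;> simp [moves]

theorem sum_moves {β : Type*} [AddCommMonoid β] (F : Move → β) :
    ((moves k).map F).sum = ∑ a : Symb, ∑ q : Fin k, ∑ d : Bool, F (a, q, d) := by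
  have h2 (a : Symb) (L : List ℕ) : ((L.flatMap fun q => [(a, q, true), (a, q, false)]).map F).sum
      = (L.map fun q => ∑ d : Bool, F (a, q, d)).sum := by
    induction L with
    | nil => simp
    | cons q L ih => simp [ih, add_assoc]
  have h1 (L : List Symb) : ((L.flatMap fun a => (List.range k).flatMap fun q =>
      [(a, q, true), (a, q, false)]).map F).sum = (L.map fun a => ((List.range k).map fun q =>
        ∑ d : Bool, F (a, q, d)).sum).sum := by
    induction L with
    | nil => simp
    | cons a L ih =>
      rw [List.flatMap_cons, List.map_append, List.sum_append, ih, h2, List.map_cons, List.sum_cons]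
  rw [moves, h1, Finset.sum_map_toList]
  refine Finset.sum_congr rfl fun a _ => ?_
  rw [← List.sum_toFinset _ List.nodup_range, List.toFinset_range]
  exact Finset.sum_range _

end QTuring

/-! ### Propagation of errors through the simulation -/

namespace QTuring

variable {k : ℕ} {q0 : Fin k} {T len r : ℕ}

/-- All configurations in the list are valid. -/
def ValidTerms (k len r : ℕ) (l : Terms) : Prop := ∀ x ∈ l, x.1.Valid k len r

theorem ValidTerms.stepTerms {amp : ℕ → Symb → Move → GaussCode} {l : Terms}
    (h : ValidTerms k len (r + 1) l) : ValidTerms k len r (stepTerms k amp l) := by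
  intro y hy
  simp only [QTuring.stepTerms, List.mem_flatMap, List.mem_map] at hy
  obtain ⟨x, hx, mv, hmv, rfl⟩ := hy
  exact (h x hx).move (mem_moves.1 hmv)

theorem ValidTerms.restrictState {l : Terms} (h : ValidTerms k len r l) (q : ℕ) :
    ValidTerms k len r (restrictState q l) := by
  intro y hy
  simp only [QTuring.restrictState, List.mem_flatMap] at hy
  obtain ⟨x, hx, hy⟩ := hy
  split_ifs at hy
  · rw [List.mem_singleton] at hy
    exact hy ▸ h x hx
  · simp at hy

theorem toVec_restrictState (q : Fin k) {l : Terms} (h : ValidTerms k len r l) :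
    toVec q0 T (restrictState q l) = stateProj q (toVec q0 T l) := by
  induction l with
  | nil => simp [toVec, restrictState]
  | cons x l ih =>
    have hx := (h x List.mem_cons_self).1
    have hiff : (x.1.config q0 T).1 = q ↔ x.1.1 = q := by
      simp [ConfCode.config, Fin.ext_iff, Nat.mod_eq_of_lt hx]
    have h' : restrictState q (x :: l) = (if x.1.1 = q then [x] else []) ++ restrictState q l := rfl
    rw [h', toVec_append, ih fun y hy => h y (List.mem_cons_of_mem _ hy), toVec_cons, map_add,
      map_smul, stateProj_ket]
    congr 1
    simp only [hiff]
    split_ifs <;> simp [toVec]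

/-- A list may contain a configuration several times; sesquilinearity takes care of repetitions.
Distinct valid codes give orthogonal kets by `ConfCode.config_injective`, so comparing codes
suffices. -/
theorem val_gram {l l' : Terms} (h : ValidTerms k len r l) (h' : ValidTerms k len r l') :
    (gram l l').val = inner ℂ (toVec q0 T l) (toVec q0 T l') := by
  classical
  have hrow (x : ConfCode × GaussCode) (hx : x.1.Valid k len r) (L : Terms)
      (hL : ValidTerms k len r L) :
      ((L.map fun y => if x.1 = y.1 then x.2.conj.mul y.2 else GaussCode.ofNat 0).map
        GaussCode.val).sum = inner ℂ (x.2.val • ket (x.1.config q0 T)) (toVec q0 T L) := by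
    induction L with
    | nil => simp [toVec]
    | cons y L ih =>
      rw [List.map_cons, List.map_cons, List.sum_cons, ih fun z hz => hL z (List.mem_cons_of_mem _ hz),
        toVec_cons, inner_add_right, inner_smul_right, inner_smul_left (ket _) (ket _), inner_ket_ket]
      congr 1
      have hy := hL y List.mem_cons_self
      have hiff : x.1.config q0 T = y.1.config q0 T ↔ x.1 = y.1 :=
        ⟨ConfCode.config_injective hx hy, fun h => by rw [h]⟩
      simp only [hiff]
      split_ifs
      · rw [GaussCode.val_mul, GaussCode.val_conj, mul_one, mul_comm]
      · rw [GaussCode.val_ofNat]; simp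
  rw [gram, GaussCode.val_sum]
  induction l with
  | nil => simp [toVec]
  | cons x l ih =>
    rw [List.flatMap_cons, List.map_append, List.sum_append,
      ih fun z hz => h z (List.mem_cons_of_mem _ hz), hrow x (h x List.mem_cons_self) l' h',
      toVec_cons, inner_add_left]

/-- There are `9 · k · 2 = 18k` moves for each term, and every one of them contributes an error of
at most `θ` times the coefficient, on a unit vector. The triangle inequality brings in the `ℓ¹` norm
`weight`. -/
theorem norm_toVec_stepTerms_sub_le {M : QTM} {amp : ℕ → Symb → Move → GaussCode} {θ : ℝ}
    (hamp : ∀ (q : Fin M.numStates) a a' (q' : Fin M.numStates) d,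
      ‖(amp q a (a', q', d)).val - M.amp q a a' q' d‖ ≤ θ)
    {l : Terms} (h : ValidTerms M.numStates len (r + 1) l) :
    ‖toVec M.q0 T (stepTerms M.numStates amp l) - M.evol (toVec M.q0 T l)‖ ≤
      18 * M.numStates * θ * weight l := by
  induction l with
  | nil => simp [toVec, stepTerms, weight]
  | cons x l ih =>
    have hx := h x List.mem_cons_self
    have h' : stepTerms M.numStates amp (x :: l) = ((moves M.numStates).map fun mv =>
      (x.1.move mv, x.2.mul (amp x.1.1 x.1.read mv))) ++ stepTerms M.numStates amp l := rfl
    have h1 : toVec M.q0 T ((moves M.numStates).map fun mv =>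
        (x.1.move mv, x.2.mul (amp x.1.1 x.1.read mv))) -
        M.evol (x.2.val • ket (x.1.config M.q0 T)) =
        ∑ a : Symb, ∑ q : Fin M.numStates, ∑ d : Bool,
          (x.2.val * ((amp x.1.1 x.1.read (a, q, d)).val -
            M.amp (x.1.config M.q0 T).1 x.1.read a q d)) •
            ket (Config.next (x.1.config M.q0 T) a q d) := by
      rw [toVec, List.map_map, sum_moves, map_smul, M.evol_ket, stepKet]
      simp only [Finset.smul_sum, ← Finset.sum_sub_distrib]
      refine Finset.sum_congr rfl fun a _ => Finset.sum_congr rfl fun q _ =>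
        Finset.sum_congr rfl fun d _ => ?_
      rw [Function.comp_apply, ConfCode.config_move hx, GaussCode.val_mul, ConfCode.config_read,
        smul_smul, mul_sub, sub_smul]
      rfl
    have hq : ((x.1.config M.q0 T).1 : ℕ) = x.1.1 := Nat.mod_eq_of_lt hx.1
    have h2 : ‖toVec M.q0 T ((moves M.numStates).map fun mv =>
        (x.1.move mv, x.2.mul (amp x.1.1 x.1.read mv))) -
        M.evol (x.2.val • ket (x.1.config M.q0 T))‖ ≤ 18 * M.numStates * θ * ‖x.2.val‖ := by
      rw [h1]
      have hterm (a : Symb) (q : Fin M.numStates) (d : Bool) :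
          ‖(x.2.val * ((amp x.1.1 x.1.read (a, q, d)).val -
            M.amp (x.1.config M.q0 T).1 x.1.read a q d)) •
            ket (Config.next (x.1.config M.q0 T) a q d)‖ ≤ ‖x.2.val‖ * θ := by
        rw [norm_smul, norm_ket, mul_one, norm_mul]
        have := hamp (x.1.config M.q0 T).1 x.1.read a q d
        rw [hq] at this
        gcongr
      refine (norm_sum_le_of_le _ fun a _ => norm_sum_le_of_le _ fun q _ =>
        norm_sum_le_of_le _ fun d _ => hterm a q d).trans_eq ?_
      have hcard : Fintype.card Symb = 9 := rfl
      simp only [Finset.sum_const, Finset.card_univ, hcard, Fintype.card_fin, Fintype.card_bool,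
        nsmul_eq_mul]
      push_cast
      ring
    rw [h', toVec_append, toVec_cons, map_add, weight_cons, mul_add, add_sub_add_comm]
    exact (norm_add_le _ _).trans
      (add_le_add h2 (ih fun y hy => h y (List.mem_cons_of_mem _ hy)))

/-- The approximate amplitudes have absolute value at most `1 + θ ≤ 2`, and each term produces `18k`
new ones. -/
theorem weight_stepTerms_le {M : QTM} {amp : ℕ → Symb → Move → GaussCode} {θ : ℝ} (hθ : θ ≤ 1)
    (hamp : ∀ (q : Fin M.numStates) a a' (q' : Fin M.numStates) d,
      ‖(amp q a (a', q', d)).val - M.amp q a a' q' d‖ ≤ θ)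
    {l : Terms} (h : ValidTerms M.numStates len r l) :
    weight (stepTerms M.numStates amp l) ≤ 36 * M.numStates * weight l := by
  induction l with
  | nil => simp [stepTerms, weight]
  | cons x l ih =>
    have hx := h x List.mem_cons_self
    have h' : stepTerms M.numStates amp (x :: l) = ((moves M.numStates).map fun mv =>
      (x.1.move mv, x.2.mul (amp x.1.1 x.1.read mv))) ++ stepTerms M.numStates amp l := rfl
    have h2 : weight ((moves M.numStates).map fun mv =>
        (x.1.move mv, x.2.mul (amp x.1.1 x.1.read mv))) ≤ 36 * M.numStates * ‖x.2.val‖ := by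
      rw [weight, List.map_map, sum_moves]
      have hterm (a : Symb) (q : Fin M.numStates) (d : Bool) :
          ‖(x.2.mul (amp x.1.1 x.1.read (a, q, d))).val‖ ≤ ‖x.2.val‖ * 2 := by
        rw [GaussCode.val_mul, norm_mul]
        have h1 := hamp ⟨x.1.1, hx.1⟩ x.1.read a q d
        have h2 := M.norm_amp_le ⟨x.1.1, hx.1⟩ x.1.read a q d
        have h3 := norm_le_norm_add_norm_sub' (amp x.1.1 x.1.read (a, q, d)).val
          (M.amp ⟨x.1.1, hx.1⟩ x.1.read a q d)
        gcongr
        linarith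
      refine (Finset.sum_le_sum fun a _ => Finset.sum_le_sum fun q _ =>
        Finset.sum_le_sum fun d _ => hterm a q d).trans_eq ?_
      have hcard : Fintype.card Symb = 9 := rfl
      simp only [Finset.sum_const, Finset.card_univ, hcard, Fintype.card_fin, Fintype.card_bool,
        nsmul_eq_mul]
      push_cast
      ring
    rw [h', weight_append, weight_cons, mul_add]
    exact add_le_add h2 (ih fun y hy => h y (List.mem_cons_of_mem _ hy))

theorem ValidTerms.iterate {amp : ℕ → Symb → Move → GaussCode} {l : Terms} (τ : ℕ)
    (h : ValidTerms k len (r + τ) l) : ValidTerms k len r ((QTuring.stepTerms k amp)^[τ] l) := by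
  induction τ generalizing r with
  | zero => exact h
  | succ τ ih =>
    rw [Function.iterate_succ_apply']
    exact (ih (r := r + 1) (by rwa [Nat.add_right_comm] at *)).stepTerms

/-- The simulation approximates the evolution. -/
theorem norm_toVec_iterate_sub_le {M : QTM} {amp : ℕ → Symb → Move → GaussCode} {θ : ℝ}
    (hθ0 : 0 ≤ θ) (hθ : θ ≤ 1)
    (hamp : ∀ (q : Fin M.numStates) a a' (q' : Fin M.numStates) d,
      ‖(amp q a (a', q', d)).val - M.amp q a a' q' d‖ ≤ θ)
    {l : Terms} (τ : ℕ) (h : ValidTerms M.numStates len (r + τ) l) :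
    ‖toVec M.q0 T ((stepTerms M.numStates amp)^[τ] l) - (M.evol ^ τ) (toVec M.q0 T l)‖ ≤
        (36 * M.numStates) ^ τ * θ * weight l ∧
      weight ((stepTerms M.numStates amp)^[τ] l) ≤ (36 * M.numStates) ^ τ * weight l := by
  induction τ generalizing r with
  | zero =>
    simp only [Function.iterate_zero, id, pow_zero, one_mul, le_refl, and_true, one_apply_eq_self,
      sub_self, norm_zero]
    exact mul_nonneg hθ0 (weight_nonneg l)
  | succ τ ih =>
    have h' : ValidTerms M.numStates len (r + 1 + τ) l := by rwa [Nat.add_right_comm, add_assoc]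
    obtain ⟨h1, h2⟩ := ih h'
    have hv := h'.iterate (amp := amp)
    have hk : (1 : ℝ) ≤ M.numStates := by exact_mod_cast Fin.pos M.q0
    have hw := weight_nonneg l
    rw [Function.iterate_succ_apply']
    set l' := (stepTerms M.numStates amp)^[τ] l
    constructor
    · have h3 := norm_toVec_stepTerms_sub_le (T := T) hamp hv
      have h4 : ‖M.evol (toVec M.q0 T l') - (M.evol ^ (τ + 1)) (toVec M.q0 T l)‖ ≤
          (36 * M.numStates) ^ τ * θ * weight l := by
        rw [pow_succ', mul_apply_eq_comp, ← map_sub, M.norm_evol_apply]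
        exact h1
      refine (norm_sub_le_norm_sub_add_norm_sub _ (M.evol (toVec M.q0 T l')) _).trans ?_
      have h5 : 18 * M.numStates * θ * weight l' ≤
          18 * M.numStates * θ * ((36 * M.numStates) ^ τ * weight l) := by gcongr
      have h6 : 0 ≤ (36 * (M.numStates : ℝ)) ^ τ * θ * weight l := by positivity
      -- The old error is preserved by the isometry and the new one is at most `18k` times the same
      -- expression. Since `1 ≤ 18k`, both fit into the factor `36k`.
      have h7 : (36 * (M.numStates : ℝ)) ^ τ * θ * weight l ≤
          18 * M.numStates * ((36 * M.numStates) ^ τ * θ * weight l) :=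
        le_mul_of_one_le_left h6 (by linarith)
      calc _ ≤ _ := add_le_add (h3.trans h5) h4
        _ ≤ _ := by rw [pow_succ]; linarith
    · refine (weight_stepTerms_le hθ hamp hv).trans ?_
      rw [pow_succ]
      calc _ ≤ 36 * M.numStates * ((36 * M.numStates) ^ τ * weight l) := by gcongr
        _ = _ := by ring

/-- The margin `T` allows `T` steps. After the last one the head may stand just beyond the window
(for `n = 0`), which is harmless because nothing is read any more. -/
theorem validTerms_initTerms (q0 : Fin k) (n T : ℕ) (v : VecCode) :
    ValidTerms k (n + 2 * T) T (initTerms q0 n T v) := by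
  intro x hx
  obtain ⟨j, _, rfl⟩ := List.mem_map.1 hx
  exact ⟨q0.2, by simp [inputWindow], le_rfl, by dsimp only; omega⟩

/-- The numbering of bit strings. -/
def bitsEquiv (n : ℕ) : (Fin n → Bool) ≃ Fin (2 ^ n) :=
  (Equiv.arrowCongr (Equiv.refl _) finTwoEquiv.symm).trans finFunctionFinEquiv

theorem bitsEquiv_apply {n : ℕ} (s : Fin n → Bool) :
    (bitsEquiv n s : ℕ) = ∑ i : Fin n, if s i then 2 ^ (i : ℕ) else 0 := by
  change ∑ i : Fin n, (finTwoEquiv.symm (s i) : ℕ) * 2 ^ (i : ℕ) = _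
  refine Finset.sum_congr rfl fun i _ => ?_
  cases s i <;> simp [finTwoEquiv]

theorem bit_bitsEquiv {n : ℕ} (s : Fin n → Bool) (i : Fin n) :
    decide ((bitsEquiv n s : ℕ) / 2 ^ (i : ℕ) % 2 = 1) = s i := by
  have h : finTwoEquiv (finFunctionFinEquiv.symm (bitsEquiv n s) i) = s i := by
    simp [bitsEquiv]
  rw [← h]
  have h2 : ((finFunctionFinEquiv.symm (bitsEquiv n s) i : Fin 2) : ℕ) =
    (bitsEquiv n s : ℕ) / 2 ^ (i : ℕ) % 2 := rfl
  rw [← h2]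
  generalize finFunctionFinEquiv.symm (bitsEquiv n s) i = b
  fin_cases b <;> rfl

theorem toQubits_apply {n : ℕ} (v : VecCode) (s : Fin n → Bool) :
    v.toQubits n s = (v.getD (bitsEquiv n s) ((0, 1), (0, 1))).val := by
  rw [bitsEquiv_apply]; rfl

theorem toVec_initTerms (M : QTM) (n T : ℕ) (v : VecCode) :
    toVec M.q0 T (initTerms M.q0 n T v) = M.embed n (v.toQubits n) := by
  rw [M.embed_apply, toVec, initTerms, List.map_map, ← List.sum_toFinset _ List.nodup_range,
    List.toFinset_range, Finset.sum_range, ← (bitsEquiv n).sum_comp]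
  refine Finset.sum_congr rfl fun s _ => ?_
  rw [toQubits_apply, Function.comp_apply]
  congr 2
  refine Prod.ext (Fin.ext (Nat.mod_eq_of_lt M.q0.2)) (Prod.ext ?_ (sub_self _))
  exact windowTape_inputWindow _ _ _ (bit_bitsEquiv s)

/-- Each of the `2^n` coordinates is bounded by the norm of the vector. -/
theorem weight_initTerms_le (q0 n T : ℕ) (v : VecCode) :
    weight (initTerms q0 n T v) ≤ 2 ^ n * ‖v.toQubits n‖ := by
  rw [weight, initTerms, List.map_map, ← List.sum_toFinset _ List.nodup_range,
    List.toFinset_range, Finset.sum_range, ← (bitsEquiv n).sum_comp]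
  refine (Finset.sum_le_card_nsmul _ _ ‖v.toQubits n‖ fun s _ => ?_).trans_eq ?_
  · rw [Function.comp_apply]
    dsimp only
    rw [← toQubits_apply]
    exact PiLp.norm_apply_le _ s
  · simp

end QTuring

/-! ### From the amplitude program to the matrix entries of the deviation operator -/

namespace QTMCode

open QTuring

variable {M : QTM} {s : QTMCode}

theorem Describes.exists_ampCode (h : s.Describes M) (m : ℕ) (q : Fin M.numStates) (a a' : Symb)
    (q' : Fin M.numStates) (d : Bool) :
    ∃ fuel₀, ∀ fuel ≥ fuel₀, (s.ampCode fuel m q a (a', q', d)).isSome := by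
  obtain ⟨z, hz, -⟩ := h.2.2.2 q a a' q' d m
  obtain ⟨fuel₀, h₀⟩ := Nat.Partrec.Code.evaln_complete.1 hz
  refine ⟨fuel₀, fun fuel hfuel => ?_⟩
  have h1 := Nat.Partrec.Code.evaln_mono hfuel h₀
  rw [Option.mem_def] at h1
  simp only [ampCode, h1, Option.bind_some, Encodable.encodek, Option.isSome_some]

/-- Only finitely many arguments occur at a fixed precision, and more fuel never spoils a
computation that has finished. -/
theorem Describes.exists_fuel (h : s.Describes M) (m : ℕ) :
    ∃ fuel, ∀ q < s.1, ∀ a ∈ (Finset.univ : Finset Symb).toList, ∀ mv ∈ moves s.1,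
      (s.ampCode fuel m q a mv).isSome := by
  have hall : ∀ᶠ fuel in Filter.atTop, ∀ (q : Fin M.numStates) (a a' : Symb)
      (q' : Fin M.numStates) (d : Bool), (s.ampCode fuel m q a (a', q', d)).isSome := by
    simp only [Filter.eventually_all]
    intro q a a' q' d
    exact Filter.eventually_atTop.2 (h.exists_ampCode m q a a' q' d)
  obtain ⟨fuel, hfuel⟩ := hall.exists
  refine ⟨fuel, fun q hq a _ mv hmv => ?_⟩
  rw [h.1] at hq hmv
  exact hfuel ⟨q, hq⟩ a mv.1 ⟨mv.2.1, mem_moves.1 hmv⟩ mv.2.2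

/-- A bounded run that succeeds agrees with the unbounded evaluation, whose value the description
guarantees. The `2` adds up the errors of the real and the imaginary part. The default `0` never
occurs here. -/
theorem Describes.norm_ampCode_sub_le (h : s.Describes M) {fuel m : ℕ}
    (hfuel : ∀ q < s.1, ∀ a ∈ (Finset.univ : Finset Symb).toList, ∀ mv ∈ moves s.1,
      (s.ampCode fuel m q a mv).isSome) (q : Fin M.numStates) (a a' : Symb)
    (q' : Fin M.numStates) (d : Bool) :
    ‖((s.ampCode fuel m q a (a', q', d)).getD (GaussCode.ofNat 0)).val - M.amp q a a' q' d‖ ≤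
      2 * 2⁻¹ ^ m := by
  obtain ⟨z, hz, hre, him⟩ := h.2.2.2 q a a' q' d m
  have h1 : (s.ampCode fuel m q a (a', q', d)).isSome := by
    refine hfuel q ?_ a (by simp) _ (mem_moves.2 ?_) <;> rw [h.1]
    exacts [q.2, q'.2]
  obtain ⟨w, hw⟩ := Option.isSome_iff_exists.1 h1
  have hw' := hw
  rw [ampCode, Option.bind_eq_some_iff] at hw'
  obtain ⟨e, he, hew⟩ := hw'
  have h2 := Part.mem_unique (Nat.Partrec.Code.evaln_sound he) hz
  rw [h2, Encodable.encodek, Option.some_inj] at hew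
  subst hew
  rw [hw, Option.getD_some, norm_sub_rev]
  refine (Complex.norm_le_abs_re_add_abs_im _).trans ?_
  rw [Complex.sub_re, Complex.sub_im, GaussCode.val_re, GaussCode.val_im]
  linarith

/-- Inner products of perturbed vectors. -/
theorem norm_inner_sub_inner_le {E : Type*} [NormedAddCommGroup E] [InnerProductSpace ℂ E]
    {a a' b b' : E} {e : ℝ} (he : e ≤ 1) (ha : ‖a - a'‖ ≤ e) (hb : ‖b - b'‖ ≤ e)
    (ha' : ‖a'‖ ≤ 2) (hb' : ‖b'‖ ≤ 2) : ‖(inner ℂ a b : ℂ) - inner ℂ a' b'‖ ≤ 5 * e := by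
  have he0 : 0 ≤ e := (norm_nonneg _).trans ha
  have h1 : (inner ℂ a b : ℂ) - inner ℂ a' b' = inner ℂ (a - a') b + inner ℂ a' (b - b') := by
    rw [inner_sub_left, inner_sub_right]; ring
  have h2 : ‖b‖ ≤ 3 := by
    have := norm_le_norm_add_norm_sub' b b'
    linarith
  rw [h1]
  calc _ ≤ ‖a - a'‖ * ‖b‖ + ‖a'‖ * ‖b - b'‖ :=
        (norm_add_le _ _).trans (add_le_add (norm_inner_le_norm _ _) (norm_inner_le_norm _ _))
    _ ≤ e * 3 + 2 * e := by gcongr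
    _ = 5 * e := by ring

theorem val_gram_initTerms (h : s.Describes M) (n t : ℕ) (v w : VecCode) :
    (gram (initTerms s.2.1 n t v) (initTerms s.2.1 n t w)).val =
      inner ℂ (v.toQubits n) (w.toQubits n) := by
  rw [h.2.1, val_gram (validTerms_initTerms M.q0 n t v) (validTerms_initTerms M.q0 n t w),
    toVec_initTerms, toVec_initTerms, M.inner_embed]

theorem run_eq (h : s.Describes M) (fuel m n T τ : ℕ) (v : VecCode) :
    s.run fuel m n T τ v = (stepTerms M.numStates fun q a mv =>
      (s.ampCode fuel m q a mv).getD (GaussCode.ofNat 0))^[τ] (initTerms M.q0 n T v) := by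
  rw [run, h.1, h.2.1]

theorem norm_simulation_sub_le {amp : ℕ → Symb → Move → GaussCode} {n t τ m : ℕ} (hτ : τ ≤ t)
    (hm : 1 ≤ m) (hamp : ∀ (q : Fin M.numStates) a a' (q' : Fin M.numStates) d,
      ‖(amp q a (a', q', d)).val - M.amp q a a' q' d‖ ≤ 2 * 2⁻¹ ^ m)
    {v : VecCode} (hv : ‖v.toQubits n‖ ≤ 2) :
    ValidTerms M.numStates (n + 2 * t) 0
      ((stepTerms M.numStates amp)^[τ] (initTerms M.q0 n t v)) ∧
    ‖stateProj M.qf (toVec M.q0 t ((stepTerms M.numStates amp)^[τ] (initTerms M.q0 n t v))) -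
      M.haltOp n τ (v.toQubits n)‖ ≤ 4 * (36 * M.numStates) ^ t * 2 ^ n * 2⁻¹ ^ m := by
  -- The window has margin `t`, but only `τ ≤ t` of it is needed.
  have hvalid : ValidTerms M.numStates (n + 2 * t) (0 + τ) (initTerms M.q0 n t v) := fun x hx => by
    obtain ⟨h1, h2, h3, h4⟩ := validTerms_initTerms M.q0 n t v x hx
    exact ⟨h1, h2, by omega, by omega⟩
  have hθ : (2 : ℝ) * 2⁻¹ ^ m ≤ 1 := by
    obtain ⟨m, rfl⟩ := Nat.exists_eq_succ_of_ne_zero (by omega : m ≠ 0)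
    rw [pow_succ]
    have : (2⁻¹ : ℝ) ^ m ≤ 1 := pow_le_one₀ (by norm_num) (by norm_num)
    linarith
  have h1 := (norm_toVec_iterate_sub_le (T := t) (by positivity) hθ hamp τ hvalid).1
  refine ⟨hvalid.iterate, ?_⟩
  rw [M.haltOp_apply, ← map_sub, ← toVec_initTerms M n t v]
  refine (norm_stateProj_le _ _).trans (h1.trans ?_)
  have hk : (1 : ℝ) ≤ M.numStates := by exact_mod_cast Fin.pos M.q0
  have hw : weight (initTerms M.q0 n t v) ≤ 2 ^ n * 2 :=
    (weight_initTerms_le _ _ _ _).trans (by gcongr)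
  have hp : (36 * (M.numStates : ℝ)) ^ τ ≤ (36 * M.numStates) ^ t :=
    pow_le_pow_right₀ (by linarith) hτ
  have hw0 := weight_nonneg (initTerms M.q0 n t v)
  -- One factor `2` is from the amplitude error `2 · 2⁻ᵐ`, the other from the bound `2` on the norm
  -- of the input vector.
  calc _ ≤ (36 * (M.numStates : ℝ)) ^ t * (2 * 2⁻¹ ^ m) * (2 ^ n * 2) := by gcongr
    _ = _ := by ring

theorem norm_run_sub_le (h : s.Describes M) {fuel m n t τ : ℕ} (hτ : τ ≤ t) (hm : 1 ≤ m)
    (hfuel : ∀ q < s.1, ∀ a ∈ (Finset.univ : Finset Symb).toList, ∀ mv ∈ moves s.1,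
      (s.ampCode fuel m q a mv).isSome) {v : VecCode} (hv : ‖v.toQubits n‖ ≤ 2) :
    ValidTerms M.numStates (n + 2 * t) 0 (s.run fuel m n t τ v) ∧
    ‖stateProj M.qf (toVec M.q0 t (s.run fuel m n t τ v)) - M.haltOp n τ (v.toQubits n)‖ ≤
      4 * (36 * M.numStates) ^ t * 2 ^ n * 2⁻¹ ^ m := by
  have hamp := h.norm_ampCode_sub_le hfuel
  rw [run_eq h]
  generalize hg : (fun (q : ℕ) (a : Symb) (mv : Move) =>
    (s.ampCode fuel m q a mv).getD (GaussCode.ofNat 0)) = amp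
  refine norm_simulation_sub_le hτ hm (fun q a a' q' d => ?_) hv
  have hq := hamp q a a' q' d
  subst hg
  exact hq

theorem norm_overlap_sub_le (h : s.Describes M) {fuel m n t τ : ℕ} (hτ : τ ≤ t) (hm : 1 ≤ m)
    (hfuel : ∀ q < s.1, ∀ a ∈ (Finset.univ : Finset Symb).toList, ∀ mv ∈ moves s.1,
      (s.ampCode fuel m q a mv).isSome) {v w : VecCode} (hv : ‖v.toQubits n‖ ≤ 2)
    (hw : ‖w.toQubits n‖ ≤ 2) (he : (4 * (36 * M.numStates) ^ t * 2 ^ n * 2⁻¹ ^ m : ℝ) ≤ 1) :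
    ‖(s.overlap fuel m n t τ v w).val -
      inner ℂ (M.haltOp n τ (v.toQubits n)) (M.haltOp n τ (w.toQubits n))‖ ≤
      5 * (4 * (36 * M.numStates) ^ t * 2 ^ n * 2⁻¹ ^ m) := by
  obtain ⟨hv1, hv2⟩ := norm_run_sub_le h hτ hm hfuel hv
  obtain ⟨hw1, hw2⟩ := norm_run_sub_le h hτ hm hfuel hw
  rw [overlap, h.2.2.1, val_gram (q0 := M.q0) (T := t) (hv1.restrictState _) (hw1.restrictState _),
    toVec_restrictState _ hv1, toVec_restrictState _ hw1]
  exact norm_inner_sub_inner_le he hv2 hw2 ((M.norm_haltOp_le _ _).trans hv)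
    ((M.norm_haltOp_le _ _).trans hw)

theorem norm_defect_sub_le (h : s.Describes M) {fuel m n t : ℕ} (hm : 1 ≤ m)
    (hfuel : ∀ q < s.1, ∀ a ∈ (Finset.univ : Finset Symb).toList, ∀ mv ∈ moves s.1,
      (s.ampCode fuel m q a mv).isSome) {v w : VecCode} (hv : ‖v.toQubits n‖ ≤ 2)
    (hw : ‖w.toQubits n‖ ≤ 2) (he : (4 * (36 * M.numStates) ^ t * 2 ^ n * 2⁻¹ ^ m : ℝ) ≤ 1) :
    ‖(s.defect fuel m n t v w).val - inner ℂ (v.toQubits n) (M.defectOp n t (w.toQubits n))‖ ≤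
      (t + 1) * (5 * (4 * (36 * M.numStates) ^ t * 2 ^ n * 2⁻¹ ^ m)) := by
  rw [M.inner_defectOp, defect, GaussCode.val_add, GaussCode.val_add, GaussCode.val_neg,
    GaussCode.val_sum, val_gram_initTerms h, List.map_map,
    ← List.sum_toFinset _ List.nodup_range, List.toFinset_range]
  have h1 := norm_overlap_sub_le h le_rfl hm hfuel hv hw he
  have h2 := norm_sum_le_of_le (Finset.range t) fun τ hτ =>
    norm_overlap_sub_le h (Finset.mem_range.1 hτ).le hm hfuel hv hw he
  rw [Finset.sum_const, Finset.card_range, nsmul_eq_mul, Finset.sum_sub_distrib] at h2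
  rw [add_sub_add_comm, show ∀ a b c : ℂ, a + -b - (a - c) = -(b - c) by intros; ring]
  refine (norm_add_le _ _).trans ?_
  rw [norm_neg, add_mul, one_mul, add_comm]
  exact add_le_add h2 h1

theorem norm_entry_sub_le {x : Input} {c : Certificate} (h : x.1.Describes M) (hf : Fueled x c)
    (hX : 0 < tolerance x c) {i j : ℕ} (hi : ‖(c.vec i).toQubits x.2.1‖ ≤ 2)
    (hj : ‖(c.vec j).toQubits x.2.1‖ ≤ 2) :
    ‖(entry x c i j).val - inner ℂ ((c.vec i).toQubits x.2.1)
      (M.defectOp x.2.1 x.2.2.1 ((c.vec j).toQubits x.2.1))‖ ≤ 1 / (2 * tolerance x c) := by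
  have hX' : (1 : ℝ) ≤ tolerance x c := by exact_mod_cast hX
  set m := precision x c with hm
  have hk : 0 < M.numStates := Fin.pos M.q0
  have hm1 : 1 ≤ m := by
    rw [hm, precision, h.1]
    exact Nat.succ_le_of_lt (by positivity)
  have hm2 : (m : ℝ) * 2⁻¹ ^ m ≤ 1 := by
    rw [inv_pow, ← div_eq_mul_inv, div_le_one (by positivity)]
    exact_mod_cast Nat.lt_two_pow_self.le
  have hm3 : (m : ℝ) = 2 * tolerance x c * ((x.2.2.1 + 1) *
      (5 * (4 * (36 * M.numStates) ^ x.2.2.1 * 2 ^ x.2.1))) := by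
    rw [hm, precision, h.1]
    push_cast
    ring
  set e : ℝ := 4 * (36 * M.numStates) ^ x.2.2.1 * 2 ^ x.2.1 * 2⁻¹ ^ m with he
  have he0 : 0 ≤ e := by positivity
  have h1 : (x.2.2.1 + 1) * (5 * e) ≤ 1 / (2 * tolerance x c) := by
    rw [le_div_iff₀ (by positivity)]
    calc _ = (m : ℝ) * 2⁻¹ ^ m := by rw [hm3, he]; ring
      _ ≤ 1 := hm2
  have h2 : e ≤ 1 := by
    have h3 : 1 / (2 * (tolerance x c : ℝ)) ≤ 1 := by
      rw [div_le_one (by positivity)]; linarith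
    have h4 : 1 * (1 * e) ≤ ((x.2.2.1 : ℝ) + 1) * (5 * e) := by
      gcongr
      · linarith [(Nat.cast_nonneg x.2.2.1 : (0 : ℝ) ≤ _)]
      · norm_num
    linarith
  exact (norm_defect_sub_le h hm1 hf hi hj h2).trans h1

end QTMCode

/-! ### Almost orthonormal, almost diagonalizing families -/

section AlmostDiagonal

variable {E : Type*} [NormedAddCommGroup E] [InnerProductSpace ℂ E] {ι : Type*} [Fintype ι]

/-- The quadratic form of a matrix with small entries is small. -/
theorem norm_sum_sum_le (G : ι → ι → ℂ) {η : ℝ} (hG : ∀ i j, ‖G i j‖ ≤ η) (c : ι → ℂ) :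
    ‖∑ i, ∑ j, (starRingEnd ℂ) (c i) * c j * G i j‖ ≤ η * (Fintype.card ι * ∑ i, ‖c i‖ ^ 2) := by
  rcases isEmpty_or_nonempty ι with hι | ⟨⟨i₀⟩⟩
  · simp
  have hη : 0 ≤ η := (norm_nonneg _).trans (hG i₀ i₀)
  calc _ ≤ ∑ i, ∑ j, ‖c i‖ * ‖c j‖ * η :=
        norm_sum_le_of_le _ fun i _ => norm_sum_le_of_le _ fun j _ => by
          rw [norm_mul, norm_mul, RCLike.norm_conj]
          gcongr
          exact hG i j
    _ = η * (∑ i, ‖c i‖) ^ 2 := by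
        rw [sq, Finset.sum_mul_sum, Finset.mul_sum]
        refine Finset.sum_congr rfl fun i _ => ?_
        rw [Finset.mul_sum]
        exact Finset.sum_congr rfl fun j _ => by ring
    _ ≤ _ := by
        gcongr
        exact sq_sum_le_card_mul_sum_sq

open Classical in
/-- The quadratic form of an operator on a combination of vectors that almost diagonalize it. -/
theorem norm_inner_sum_sub_le (A : E →ₗ[ℂ] E) (v : ι → E) (D : ι → ℂ) {η : ℝ}
    (h : ∀ i j, ‖(inner ℂ (v i) (A (v j)) : ℂ) - if i = j then D i else 0‖ ≤ η) (c : ι → ℂ) :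
    ‖(inner ℂ (∑ i, c i • v i) (A (∑ i, c i • v i)) : ℂ) - ∑ i, (‖c i‖ ^ 2 : ℝ) * D i‖ ≤
      η * (Fintype.card ι * ∑ i, ‖c i‖ ^ 2) := by
  refine le_of_eq_of_le (congrArg _ ?_) (norm_sum_sum_le _ h c)
  rw [map_sum, sum_inner]
  simp only [inner_sum, map_smul, inner_smul_left, inner_smul_right, mul_sub,
    Finset.sum_sub_distrib]
  congr 1
  · refine Finset.sum_congr rfl fun i _ => Finset.sum_congr rfl fun j _ => by ring
  · refine Finset.sum_congr rfl fun i _ => ?_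
    rw [Finset.sum_eq_single i (fun j _ hj => by rw [if_neg hj.symm, mul_zero]) (by simp),
      if_pos rfl]
    congr 1
    rw [mul_comm, Complex.mul_conj, Complex.normSq_eq_norm_sq]

open Classical in
/-- An almost orthonormal family. -/
theorem norm_sum_sq_sub_le {v : ι → E} {η : ℝ} (hη : Fintype.card ι * η ≤ 1 / 2)
    (h : ∀ i j, ‖(inner ℂ (v i) (v j) : ℂ) - if i = j then 1 else 0‖ ≤ η) (c : ι → ℂ) :
    ∑ i, ‖c i‖ ^ 2 ≤ 2 * ‖∑ i, c i • v i‖ ^ 2 ∧ ‖∑ i, c i • v i‖ ^ 2 ≤ 2 * ∑ i, ‖c i‖ ^ 2 := by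
  have h1 := norm_inner_sum_sub_le LinearMap.id v (fun _ => 1) h c
  have h2 := (Complex.abs_re_le_norm _).trans h1
  have h3 : (inner ℂ (∑ i, c i • v i) (∑ i, c i • v i) : ℂ).re = ‖∑ i, c i • v i‖ ^ 2 :=
    inner_self_eq_norm_sq (𝕜 := ℂ) _
  simp only [LinearMap.id_coe, id, mul_one, Complex.sub_re, h3, Complex.re_sum,
    Complex.ofReal_re] at h2
  have h4 : 0 ≤ ∑ i, ‖c i‖ ^ 2 := by positivity
  have h5 : η * (Fintype.card ι * ∑ i, ‖c i‖ ^ 2) ≤ 1 / 2 * ∑ i, ‖c i‖ ^ 2 := by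
    rw [← mul_assoc, mul_comm η]
    gcongr
  have h6 := abs_le.1 (h2.trans h5)
  constructor <;> linarith

open Classical in
theorem linearIndependent_of_almost_orthonormal {v : ι → E} {η : ℝ}
    (hη : Fintype.card ι * η ≤ 1 / 2)
    (h : ∀ i j, ‖(inner ℂ (v i) (v j) : ℂ) - if i = j then 1 else 0‖ ≤ η) :
    LinearIndependent ℂ v := by
  rw [Fintype.linearIndependent_iff]
  intro c hc i
  have h1 := (norm_sum_sq_sub_le hη h c).1
  rw [hc, norm_zero] at h1
  have h2 := Finset.single_le_sum (fun j _ => sq_nonneg ‖c j‖) (Finset.mem_univ i)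
  have h3 : ‖c i‖ ^ 2 ≤ 0 := by linarith
  exact norm_eq_zero.1 (pow_eq_zero_iff two_ne_zero |>.1 (le_antisymm h3 (sq_nonneg _)))

variable {A : E →ₗ[ℂ] E} {v : ι → E} {S : Set ι} {η μ : ℝ}

open Classical in
/-- The quadratic form of `A` on a combination of vectors. -/
theorem re_inner_sum_bounds (hη : Fintype.card ι * η ≤ 1 / 2)
    (h : ∀ i j, ‖(inner ℂ (v i) (v j) : ℂ) - if i = j then 1 else 0‖ ≤ η)
    (hA : ∀ i j, i ≠ j ∨ i ∈ S → ‖(inner ℂ (v i) (A (v j)) : ℂ)‖ ≤ η) (hη0 : 0 ≤ η) (c : ι → ℂ) :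
    |(inner ℂ (∑ i, c i • v i) (A (∑ i, c i • v i)) : ℂ).re -
      ∑ i, ‖c i‖ ^ 2 * if i ∈ S then 0 else (inner ℂ (v i) (A (v i)) : ℂ).re| ≤
      2 * Fintype.card ι * η * ‖∑ i, c i • v i‖ ^ 2 := by
  have h1 := norm_inner_sum_sub_le A v
    (fun i => if i ∈ S then 0 else (inner ℂ (v i) (A (v i)) : ℂ)) (η := η) (fun i j => by
      by_cases hij : i = j
      · subst hij
        by_cases hS : i ∈ S
        · simpa [hS] using hA i i (Or.inr hS)
        · simpa [hS] using hη0
      · simpa [hij] using hA i j (Or.inl hij)) c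
  have h2 := (Complex.abs_re_le_norm _).trans h1
  rw [Complex.sub_re, Complex.re_sum] at h2
  have h3 : ∀ i, (((‖c i‖ ^ 2 : ℝ) : ℂ) * if i ∈ S then 0 else (inner ℂ (v i) (A (v i)) : ℂ)).re =
      ‖c i‖ ^ 2 * if i ∈ S then 0 else (inner ℂ (v i) (A (v i)) : ℂ).re := fun i => by
    rw [Complex.re_ofReal_mul]
    split_ifs <;> simp
  simp only [h3] at h2
  refine h2.trans ?_
  have h4 := (norm_sum_sq_sub_le hη h c).1
  calc _ ≤ η * (Fintype.card ι * (2 * ‖∑ i, c i • v i‖ ^ 2)) := by gcongr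
    _ = _ := by ring

open Classical in
/-- The quadratic form is small on the span of the vectors in the almost-kernel. -/
theorem re_inner_le_of_mem_span (hη : Fintype.card ι * η ≤ 1 / 2)
    (h : ∀ i j, ‖(inner ℂ (v i) (v j) : ℂ) - if i = j then 1 else 0‖ ≤ η)
    (hA : ∀ i j, i ≠ j ∨ i ∈ S → ‖(inner ℂ (v i) (A (v j)) : ℂ)‖ ≤ η) (hη0 : 0 ≤ η) {ψ : E}
    (hψ : ψ ∈ Submodule.span ℂ (v '' S)) :
    (inner ℂ ψ (A ψ) : ℂ).re ≤ 2 * Fintype.card ι * η * ‖ψ‖ ^ 2 := by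
  obtain ⟨c, hc, rfl⟩ : ∃ c : ι → ℂ, (∀ i ∉ S, c i = 0) ∧ ∑ i, c i • v i = ψ := by
    obtain ⟨l, hl, rfl⟩ := (Finsupp.mem_span_image_iff_linearCombination ℂ).1 hψ
    refine ⟨l, fun i hi => ?_, ?_⟩
    · by_contra hne
      exact hi (hl (Finsupp.mem_support_iff.2 hne))
    · rw [Finsupp.linearCombination_apply, Finsupp.sum_fintype _ _ (by simp)]
  have h1 := (abs_le.1 (re_inner_sum_bounds hη h hA hη0 c)).2
  have h2 : ∑ i, ‖c i‖ ^ 2 * (if i ∈ S then 0 else (inner ℂ (v i) (A (v i)) : ℂ).re) = 0 :=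
    Finset.sum_eq_zero fun i _ => by
      by_cases hS : i ∈ S
      · simp [hS]
      · simp [hc i hS]
  linarith

open Classical in
/-- Vectors on which the quadratic form is small are close to the span of the almost-kernel. -/
theorem exists_mem_span_norm_sub_le [FiniteDimensional ℂ E]
    (hdim : Fintype.card ι = Module.finrank ℂ E) (hη : Fintype.card ι * η ≤ 1 / 2)
    (h : ∀ i j, ‖(inner ℂ (v i) (v j) : ℂ) - if i = j then 1 else 0‖ ≤ η)
    (hA : ∀ i j, i ≠ j ∨ i ∈ S → ‖(inner ℂ (v i) (A (v j)) : ℂ)‖ ≤ η) (hη0 : 0 ≤ η) (hμ : 0 < μ)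
    (hgap : ∀ i ∉ S, μ ≤ (inner ℂ (v i) (A (v i)) : ℂ).re) (ψ : E) :
    ∃ φ ∈ Submodule.span ℂ (v '' S), ‖ψ - φ‖ ^ 2 ≤
      2 * ((inner ℂ ψ (A ψ) : ℂ).re + 2 * Fintype.card ι * η * ‖ψ‖ ^ 2) / μ := by
  have hli := linearIndependent_of_almost_orthonormal hη h
  have hspan : ψ ∈ Submodule.span ℂ (Set.range v) := by
    rw [hli.span_eq_top_of_card_eq_finrank' hdim]
    trivial
  obtain ⟨c, rfl⟩ := (Submodule.mem_span_range_iff_exists_fun ℂ).1 hspan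
  refine ⟨∑ i, (if i ∈ S then c i else 0) • v i, Submodule.sum_mem _ fun i _ => ?_, ?_⟩
  · split_ifs with hi
    · exact Submodule.smul_mem _ _ (Submodule.subset_span ⟨i, hi, rfl⟩)
    · simp
  · have h1 : ∑ i, c i • v i - ∑ i, (if i ∈ S then c i else 0) • v i =
        ∑ i, (if i ∈ S then 0 else c i) • v i := by
      rw [← Finset.sum_sub_distrib]
      refine Finset.sum_congr rfl fun i _ => ?_
      split_ifs <;> simp
    rw [h1, le_div_iff₀ hμ]
    have h2 := (norm_sum_sq_sub_le hη h fun i => if i ∈ S then 0 else c i).2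
    have h3 := (abs_le.1 (re_inner_sum_bounds hη h hA hη0 c)).1
    -- The coefficients outside `S` are exactly those dropped from `ψ`, and each is weighted in the
    -- form by a diagonal entry of at least `μ`; so the form bounds the dropped part.
    have h4 : (∑ i, ‖if i ∈ S then 0 else c i‖ ^ 2) * μ ≤
        ∑ i, ‖c i‖ ^ 2 * if i ∈ S then 0 else (inner ℂ (v i) (A (v i)) : ℂ).re := by
      rw [Finset.sum_mul]
      refine Finset.sum_le_sum fun i _ => ?_
      by_cases hi : i ∈ S
      · simp [hi]
      · simp only [hi, if_false]
        exact mul_le_mul_of_nonneg_left (hgap i hi) (sq_nonneg _)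
    nlinarith

/-- Passing to a unit vector. -/
theorem exists_unit_norm_sub_le {V : Submodule ℂ E} {ψ φ : E} {d : ℝ} (hψ : ‖ψ‖ = 1) (hφ : φ ∈ V)
    (h : ‖ψ - φ‖ ≤ d) (hd : d < 1) : ∃ φ' ∈ V, ‖φ'‖ = 1 ∧ ‖ψ - φ'‖ ≤ 2 * d := by
  have h1 : |‖ψ‖ - ‖φ‖| ≤ d := (abs_norm_sub_norm_le _ _).trans h
  rw [hψ, abs_le] at h1
  have h0 : 0 < ‖φ‖ := by linarith
  refine ⟨((‖φ‖⁻¹ : ℝ) : ℂ) • φ, V.smul_mem _ hφ, ?_, ?_⟩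
  · rw [norm_smul, Complex.norm_real, norm_inv, norm_norm, inv_mul_cancel₀ h0.ne']
  · have h2 : ‖φ - ((‖φ‖⁻¹ : ℝ) : ℂ) • φ‖ = |‖φ‖ - 1| := by
      have : φ - ((‖φ‖⁻¹ : ℝ) : ℂ) • φ = ((1 - ‖φ‖⁻¹ : ℝ) : ℂ) • φ := by
        rw [Complex.ofReal_sub, sub_smul, Complex.ofReal_one, one_smul]
      rw [this, norm_smul, Complex.norm_real, Real.norm_eq_abs, ← abs_of_pos h0, ← abs_mul,
        abs_of_pos h0, sub_mul, inv_mul_cancel₀ h0.ne', one_mul]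
    have h3 : |‖φ‖ - 1| ≤ d := abs_le.2 ⟨by linarith, by linarith⟩
    calc _ ≤ ‖ψ - φ‖ + ‖φ - ((‖φ‖⁻¹ : ℝ) : ℂ) • φ‖ := norm_sub_le_norm_sub_add_norm_sub _ _ _
      _ ≤ d + d := by rw [h2]; exact add_le_add h h3
      _ = 2 * d := by ring

end AlmostDiagonal

/-! ### Soundness: what an accepted certificate guarantees -/

namespace QTMCode

open QTuring

variable {M : QTM} {x : Input} {c : Certificate}

/-- The acceptance test bounds absolute values; positivity of the operator turns such a bound on a
diagonal entry into one on its real part. -/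
theorem _root_.QTM.norm_inner_defectOp_self (M : QTM) {n : ℕ} (t : ℕ) (ψ : Qubits n) :
    ‖(inner ℂ ψ (M.defectOp n t ψ) : ℂ)‖ = (inner ℂ ψ (M.defectOp n t ψ)).re := by
  have h : (inner ℂ (M.defectOp n t ψ) ψ : ℂ) = inner ℂ ψ (M.defectOp n t ψ) :=
    M.isSymmetric_defectOp n t ψ ψ
  rw [← inner_conj_symm, Complex.conj_eq_iff_im] at h
  rw [← Complex.abs_re_eq_norm.2 h, abs_of_nonneg (M.re_inner_defectOp_nonneg t ψ)]

/-- The vectors of a certificate. -/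
noncomputable def Certificate.vector (c : Certificate) (n : ℕ) (i : Fin (2 ^ n)) : Qubits n :=
  (c.vec i).toQubits n

theorem val_gram_sub_delta (h : x.1.Describes M) (c : Certificate) (i j : Fin (2 ^ x.2.1)) :
    ((gram (initTerms x.1.2.1 x.2.1 x.2.2.1 (c.vec i))
      (initTerms x.1.2.1 x.2.1 x.2.2.1 (c.vec j))).add
      (GaussCode.ofNat (if (i : ℕ) = j then 1 else 0)).neg).val =
      (inner ℂ (c.vector _ i) (c.vector _ j) : ℂ) - if i = j then 1 else 0 := by
  rw [GaussCode.val_add, GaussCode.val_neg, GaussCode.val_ofNat, val_gram_initTerms h,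
    ← sub_eq_add_neg]
  simp only [Fin.ext_iff]
  split_ifs <;> simp [Certificate.vector]

theorem cast_tolerance (x : Input) (c : Certificate) :
    (tolerance x c : ℝ) = 128 * 2 ^ x.2.1 * c.2.1 * x.2.2.2.2 ^ 2 := by
  simp [tolerance]

theorem tolerance_pos (hD : 0 < x.2.2.2.2) (hg : 0 < c.2.1) : 0 < tolerance x c := by
  unfold tolerance
  positivity

/-- The almost-kernel indices of a certificate. -/
def Certificate.kernelIndices (c : Certificate) (n : ℕ) : Set (Fin (2 ^ n)) :=
  {i | (i : ℕ) < c.1.1.length}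

namespace Accepts

theorem norm_inner_sub_le (ha : Accepts x c) (h : x.1.Describes M) (hD : 0 < x.2.2.2.2)
    (i j : Fin (2 ^ x.2.1)) :
    ‖(inner ℂ (c.vector _ i) (c.vector _ j) : ℂ) - if i = j then 1 else 0‖ ≤
      1 / tolerance x c := by
  have h1 := (ha.2.2 i i.2 j j.2).1
  rw [GaussCode.small_iff, val_gram_sub_delta h] at h1
  have : (0 : ℝ) < tolerance x c := by exact_mod_cast tolerance_pos hD ha.1.2
  rwa [le_div_iff₀' this]

theorem norm_vector_le (ha : Accepts x c) (h : x.1.Describes M) (hD : 0 < x.2.2.2.2)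
    (i : Fin (2 ^ x.2.1)) : ‖c.vector _ i‖ ≤ 2 := by
  have h1 := ha.norm_inner_sub_le h hD i i
  have hX : (1 : ℝ) ≤ tolerance x c := by exact_mod_cast tolerance_pos hD ha.1.2
  have h2 : 1 / (tolerance x c : ℝ) ≤ 1 := by rw [div_le_one (by linarith)]; exact hX
  have h3 := (Complex.abs_re_le_norm _).trans (h1.trans h2)
  have h4 : (inner ℂ (c.vector x.2.1 i) (c.vector x.2.1 i) : ℂ).re = ‖c.vector _ i‖ ^ 2 :=
    inner_self_eq_norm_sq (𝕜 := ℂ) _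
  rw [if_pos rfl, Complex.sub_re, h4, Complex.one_re, abs_le] at h3
  nlinarith [norm_nonneg (c.vector x.2.1 i)]

theorem norm_entry_sub_le (ha : Accepts x c) (h : x.1.Describes M) (hD : 0 < x.2.2.2.2)
    (i j : Fin (2 ^ x.2.1)) :
    ‖(entry x c i j).val -
      inner ℂ (c.vector _ i) (M.defectOp x.2.1 x.2.2.1 (c.vector _ j))‖ ≤
      1 / (2 * tolerance x c) :=
  QTMCode.norm_entry_sub_le h ha.2.1 (tolerance_pos hD ha.1.2) (ha.norm_vector_le h hD i)
    (ha.norm_vector_le h hD j)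

theorem norm_inner_defectOp_le (ha : Accepts x c) (h : x.1.Describes M) (hD : 0 < x.2.2.2.2)
    (i j : Fin (2 ^ x.2.1)) (hij : i ≠ j ∨ i ∈ c.kernelIndices _) :
    ‖(inner ℂ (c.vector _ i) (M.defectOp x.2.1 x.2.2.1 (c.vector _ j)) : ℂ)‖ ≤
      2 / tolerance x c := by
  have h1 := (ha.2.2 i i.2 j j.2).2
  rw [if_neg (by
    rintro ⟨h1, h2⟩
    rcases hij with h3 | h3
    · exact h3 (Fin.ext h1)
    · exact absurd h3 (not_lt.2 h2)), GaussCode.small_iff] at h1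
  have hX : (0 : ℝ) < tolerance x c := by exact_mod_cast tolerance_pos hD ha.1.2
  rw [← le_div_iff₀' hX] at h1
  have h2 := ha.norm_entry_sub_le h hD i j
  have h3 := norm_le_norm_add_norm_sub (entry x c i j).val
    (inner ℂ (c.vector _ i) (M.defectOp x.2.1 x.2.2.1 (c.vector _ j)))
  have h4 : 1 / (2 * (tolerance x c : ℝ)) ≤ 1 / tolerance x c := by
    apply one_div_le_one_div_of_le hX; linarith
  calc _ ≤ _ := h3
    _ ≤ 1 / (tolerance x c : ℝ) + 1 / tolerance x c := by linarith
    _ = _ := by ring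

/-- The approximate entry exceeds `1/g` and its error is at most `1/(2X) ≤ 1/(2g)`, so half of the
certified gap survives. -/
theorem le_re_inner_defectOp (ha : Accepts x c) (h : x.1.Describes M) (hD : 0 < x.2.2.2.2)
    (i : Fin (2 ^ x.2.1)) (hi : i ∉ c.kernelIndices _) :
    1 / (2 * (c.2.1 : ℝ)) ≤
      (inner ℂ (c.vector _ i) (M.defectOp x.2.1 x.2.2.1 (c.vector _ i)) : ℂ).re := by
  have h1 := (ha.2.2 i i.2 i i.2).2
  rw [if_pos ⟨rfl, not_lt.1 hi⟩, GaussCode.small_iff, not_le] at h1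
  have hg : (0 : ℝ) < c.2.1 := by exact_mod_cast ha.1.2
  rw [← div_lt_iff₀' hg] at h1
  have h2 := ha.norm_entry_sub_le h hD i i
  have h3 := norm_le_norm_add_norm_sub' (entry x c i i).val
    (inner ℂ (c.vector _ i) (M.defectOp x.2.1 x.2.2.1 (c.vector _ i)))
  rw [M.norm_inner_defectOp_self] at h3
  have h4 : 1 / (2 * (tolerance x c : ℝ)) ≤ 1 / (2 * c.2.1) := by
    apply one_div_le_one_div_of_le (by positivity)
    have hD' : 1 ≤ x.2.2.2.2 := hD
    have : c.2.1 ≤ tolerance x c := by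
      unfold tolerance
      rw [show 128 * 2 ^ x.2.1 * c.2.1 * x.2.2.2.2 ^ 2 =
        c.2.1 * (128 * 2 ^ x.2.1 * x.2.2.2.2 ^ 2) by ring]
      exact Nat.le_mul_of_pos_right _ (by positivity)
    have : (c.2.1 : ℝ) ≤ tolerance x c := by exact_mod_cast this
    linarith
  have h5 : 1 / (c.2.1 : ℝ) = 1 / (2 * c.2.1) + 1 / (2 * c.2.1) := by field_simp; norm_num
  linarith

theorem card_mul_le (ha : Accepts x c) (hD : 0 < x.2.2.2.2) :
    (Fintype.card (Fin (2 ^ x.2.1)) : ℝ) * (2 / tolerance x c) =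
      1 / (64 * c.2.1 * x.2.2.2.2 ^ 2) := by
  have hg : (0 : ℝ) < c.2.1 := by exact_mod_cast ha.1.2
  have hD' : (0 : ℝ) < x.2.2.2.2 := by exact_mod_cast hD
  rw [cast_tolerance, Fintype.card_fin]
  push_cast
  field_simp
  norm_num

theorem card_mul_le_half (ha : Accepts x c) (hD : 0 < x.2.2.2.2) :
    (Fintype.card (Fin (2 ^ x.2.1)) : ℝ) * (2 / tolerance x c) ≤ 1 / 2 := by
  rw [ha.card_mul_le hD]
  apply one_div_le_one_div_of_le (by norm_num)
  have : 1 ≤ c.2.1 * x.2.2.2.2 ^ 2 := Nat.mul_pos ha.1.2 (by positivity)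
  have : (1 : ℝ) ≤ c.2.1 * x.2.2.2.2 ^ 2 := by exact_mod_cast this
  linarith

/-- The weaker bound lets near-orthonormality and near-diagonality share the parameter `η = 2/X`. -/
theorem norm_inner_sub_le' (ha : Accepts x c) (h : x.1.Describes M) (hD : 0 < x.2.2.2.2)
    (i j : Fin (2 ^ x.2.1)) :
    ‖(inner ℂ (c.vector _ i) (c.vector _ j) : ℂ) - if i = j then 1 else 0‖ ≤
      2 / tolerance x c := by
  refine (ha.norm_inner_sub_le h hD i j).trans ?_
  gcongr
  norm_num

/-- The approximate halting space of a certificate. -/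
noncomputable def _root_.QTMCode.Certificate.space (c : Certificate) (n : ℕ) :
    Submodule ℂ (Qubits n) :=
  Submodule.span ℂ (Set.range fun i : Fin c.1.1.length => VecCode.toQubits n c.1.1[i])

theorem length_le (ha : Accepts x c) : c.1.1.length ≤ 2 ^ x.2.1 := by
  have := ha.1.1
  rw [List.length_append] at this
  omega

theorem _root_.QTMCode.Certificate.vec_of_lt (c : Certificate) {i : ℕ} (hi : i < c.1.1.length) :
    c.vec i = c.1.1[i] := by
  rw [Certificate.vec, List.getD_append _ _ _ _ hi, List.getD_eq_getElem _ _ hi]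

theorem describesSubspace (ha : Accepts x c) (h : x.1.Describes M) (hD : 0 < x.2.2.2.2) :
    DescribesSubspace c.1.1 (c.space x.2.1) := by
  classical
  refine ⟨?_, rfl⟩
  have hli := linearIndependent_of_almost_orthonormal (ha.card_mul_le_half hD)
    fun i j => by convert ha.norm_inner_sub_le' h hD i j
  have heq : (fun i : Fin c.1.1.length => VecCode.toQubits x.2.1 c.1.1[i]) =
      c.vector x.2.1 ∘ Fin.castLE ha.length_le := funext fun i => by
    rw [Function.comp_apply, Certificate.vector, Fin.val_castLE, c.vec_of_lt i.2]
    rfl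
  rw [heq]
  exact hli.comp _ (Fin.castLE_injective _)

theorem space_eq (ha : Accepts x c) :
    c.space x.2.1 = Submodule.span ℂ (c.vector x.2.1 '' c.kernelIndices _) := by
  unfold Certificate.space
  congr 1
  ext ψ
  constructor
  · rintro ⟨i, rfl⟩
    refine ⟨Fin.castLE ha.length_le i, i.2, ?_⟩
    rw [Certificate.vector, Fin.val_castLE, c.vec_of_lt i.2]
    rfl
  · rintro ⟨i, hi, rfl⟩
    refine ⟨⟨i, hi⟩, ?_⟩
    rw [Certificate.vector, c.vec_of_lt hi]
    rfl

/-- Near-diagonality alone bounds the form by `1/(32gD²)`, which is well below `1/D`. -/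
theorem re_inner_le (ha : Accepts x c) (h : x.1.Describes M) (hD : 0 < x.2.2.2.2)
    {ψ : Qubits x.2.1} (hψ : ψ ∈ c.space x.2.1) (h1 : ‖ψ‖ = 1) :
    (inner ℂ ψ (M.defectOp x.2.1 x.2.2.1 ψ)).re ≤ 1 / x.2.2.2.2 := by
  classical
  rw [ha.space_eq] at hψ
  have h2 := re_inner_le_of_mem_span 
    (A := (M.defectOp x.2.1 x.2.2.1 : Qubits _ →ₗ[ℂ] Qubits _)) (S := c.kernelIndices _)
    (v := c.vector x.2.1) (η := 2 / tolerance x c)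
    (ha.card_mul_le_half hD) (fun i j => by convert ha.norm_inner_sub_le' h hD i j)
    (ha.norm_inner_defectOp_le h hD) (by positivity) hψ
  rw [h1, mul_assoc 2, ha.card_mul_le hD] at h2
  refine h2.trans ?_
  have hg : (1 : ℝ) ≤ c.2.1 := by exact_mod_cast ha.1.2
  have hD' : (1 : ℝ) ≤ x.2.2.2.2 := by exact_mod_cast hD
  calc 2 * (1 / (64 * (c.2.1 : ℝ) * x.2.2.2.2 ^ 2)) * 1 ^ 2
      = 1 / (32 * c.2.1 * x.2.2.2.2) * (1 / x.2.2.2.2) := by field_simp; norm_num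
    _ ≤ 1 * (1 / x.2.2.2.2) := by
        gcongr
        rw [div_le_one (by positivity)]
        exact one_le_mul_of_one_le_of_one_le (by linarith) hD'
    _ = _ := one_mul _

/-- The hypothesis and the errors of the certificate contribute `1/(32gD²)` each. Dividing by the
gap `1/(2g)` gives a squared distance of at most `1/(4D²)` to the space; normalizing doubles the
distance `1/(2D)`. -/
theorem exists_near (ha : Accepts x c) (h : x.1.Describes M) (hD : 0 < x.2.2.2.2)
    {ψ : Qubits x.2.1} (h1 : ‖ψ‖ = 1) (h2 : (inner ℂ ψ (M.defectOp x.2.1 x.2.2.1 ψ)).re ≤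
      1 / (32 * c.2.1 * x.2.2.2.2 ^ 2)) :
    ∃ φ ∈ c.space x.2.1, ‖φ‖ = 1 ∧ ‖ψ - φ‖ ≤ 1 / x.2.2.2.2 := by
  classical
  have hg : (1 : ℝ) ≤ c.2.1 := by exact_mod_cast ha.1.2
  have hD' : (1 : ℝ) ≤ x.2.2.2.2 := by exact_mod_cast hD
  obtain ⟨φ, hφ, h3⟩ := exists_mem_span_norm_sub_le
    (A := (M.defectOp x.2.1 x.2.2.1 : Qubits _ →ₗ[ℂ] Qubits _)) (S := c.kernelIndices _)
    (v := c.vector x.2.1) (η := 2 / tolerance x c) (μ := 1 / (2 * (c.2.1 : ℝ))) (by simp) (ha.card_mul_le_half hD)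
    (fun i j => by convert ha.norm_inner_sub_le' h hD i j)
    (ha.norm_inner_defectOp_le h hD) (by positivity) (by positivity)
    (ha.le_re_inner_defectOp h hD) ψ
  rw [← ha.space_eq] at hφ
  have h4 : ‖ψ - φ‖ ≤ 1 / (2 * x.2.2.2.2) := by
    refine (pow_le_pow_iff_left₀ (norm_nonneg _) (by positivity) two_ne_zero).1 ?_
    refine h3.trans ?_
    rw [h1, mul_assoc 2 _ (2 / (tolerance x c : ℝ)), ha.card_mul_le hD]
    calc _ ≤ 2 * (1 / (32 * c.2.1 * x.2.2.2.2 ^ 2) +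
          2 * (1 / (64 * c.2.1 * x.2.2.2.2 ^ 2)) * 1 ^ 2) / (1 / (2 * (c.2.1 : ℝ))) := by gcongr; exact h2
      _ = _ := by field_simp; norm_num
  obtain ⟨φ', hφ', h5, h6⟩ := exists_unit_norm_sub_le h1 hφ h4 (by
    rw [div_lt_one (by positivity)]; linarith)
  refine ⟨φ', hφ', h5, h6.trans_eq ?_⟩
  field_simp

end Accepts

end QTMCode

/-! ### Density of the coded vectors -/

theorem GaussCode.denseRange_val : DenseRange GaussCode.val := by
  have h : DenseRange (Complex.equivRealProdCLM.symm ∘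
      Prod.map ((↑) : ℚ → ℝ) ((↑) : ℚ → ℝ)) :=
    Complex.equivRealProdCLM.symm.surjective.denseRange.comp
      (Rat.denseRange_cast.prodMap Rat.denseRange_cast)
      Complex.equivRealProdCLM.symm.continuous
  refine h.mono ?_
  rintro _ ⟨q, rfl⟩
  refine ⟨(RatCode.ofRat q.1, RatCode.ofRat q.2), ?_⟩
  rw [Function.comp_apply, Complex.equivRealProdCLM_symm_apply]
  simp [GaussCode.val, RatCode.val_ofRat]

theorem VecCode.denseRange_toQubits (n : ℕ) : DenseRange (VecCode.toQubits n) := by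
  have h : DenseRange ((WithLp.toLp 2 : ((Fin n → Bool) → ℂ) → Qubits n) ∘
      Pi.map fun _ : Fin n → Bool => GaussCode.val) :=
    (WithLp.toLp_surjective 2).denseRange.comp
      (DenseRange.piMap fun _ => GaussCode.denseRange_val) (PiLp.continuous_toLp 2 _)
  refine h.mono ?_
  rintro _ ⟨g, rfl⟩
  refine ⟨List.ofFn fun j => g ((QTuring.bitsEquiv n).symm j), ?_⟩
  ext s
  rw [QTuring.toQubits_apply, List.getD_eq_getElem _ _ (by simp), List.getElem_ofFn]
  simp

/-! ### Completeness: every machine description has an accepted certificate -/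

namespace QTMCode

open QTuring

variable {M : QTM} {s : QTMCode}

/-- An orthonormal eigenbasis with a spectral gap. -/
theorem _root_.QTM.exists_eigenbasis (M : QTM) (n t : ℕ) :
    ∃ (b : OrthonormalBasis (Fin (2 ^ n)) ℂ (Qubits n)) (ev : Fin (2 ^ n) → ℝ) (g : ℕ), 0 < g ∧
      (∀ i, M.defectOp n t (b i) = (ev i : ℂ) • b i) ∧ ∀ i, ev i = 0 ∨ 3 / g ≤ ev i := by
  have hdim : Module.finrank ℂ (Qubits n) = 2 ^ n := by simp
  set b := (M.isSymmetric_defectOp n t).eigenvectorBasis hdim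
  set ev := (M.isSymmetric_defectOp n t).eigenvalues hdim
  have hb (i) : M.defectOp n t (b i) = (ev i : ℂ) • b i :=
    (M.isSymmetric_defectOp n t).apply_eigenvectorBasis hdim i
  have hev (i) : 0 ≤ ev i := by
    have h1 := M.re_inner_defectOp_nonneg t (b i)
    rw [hb, inner_smul_right, inner_self_eq_norm_sq_to_K, b.norm_eq_one] at h1
    simpa using h1
  -- Of the gap `3/g`, one unit is given up to approximation errors; the remaining `2/g` still
  -- strictly exceeds the threshold `1/g` of the test.
  have hgap : ∀ᶠ g : ℕ in Filter.atTop, 0 < g ∧ ∀ i, ev i = 0 ∨ 3 / (g : ℝ) ≤ ev i := by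
    refine (Filter.eventually_gt_atTop 0).and (Filter.eventually_all.2 fun i => ?_)
    rcases (hev i).eq_or_lt with h | h
    · exact Filter.Eventually.of_forall fun _ => Or.inl h.symm
    · have hlim : Filter.Tendsto (fun g : ℕ => 3 / (g : ℝ)) Filter.atTop (nhds 0) :=
        tendsto_const_div_atTop_nhds_zero_nat 3
      exact (hlim.eventually_le_const h).mono fun _ h => Or.inr h
  obtain ⟨g, hg0, hg⟩ := hgap.exists
  exact ⟨b, ev, g, hg0, hb, hg⟩

open Classical in
/-- Coded vectors close to an eigenbasis. -/
theorem exists_coded_eigenbasis {n : ℕ} (A : Qubits n →L[ℂ] Qubits n)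
    (b : OrthonormalBasis (Fin (2 ^ n)) ℂ (Qubits n)) (ev : Fin (2 ^ n) → ℝ)
    (hb : ∀ i, A (b i) = (ev i : ℂ) • b i) {e : ℝ} (he : 0 < e) :
    ∃ r : Fin (2 ^ n) → VecCode, (∀ i, ‖(r i).toQubits n‖ ≤ 2) ∧ ∀ i j,
      ‖(inner ℂ ((r i).toQubits n) ((r j).toQubits n) : ℂ) - if i = j then 1 else 0‖ ≤ e ∧
      ‖(inner ℂ ((r i).toQubits n) (A ((r j).toQubits n)) : ℂ) -
        if i = j then (ev i : ℂ) else 0‖ ≤ e := by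
  -- The exact eigenbasis satisfies all these finitely many conditions with room to spare, so by
  -- continuity they persist nearby, where density supplies coded vectors.
  have hopen : ∀ᶠ u : Fin (2 ^ n) → Qubits n in nhds (fun i => b i),
      (∀ i, ‖u i‖ ≤ 2) ∧ ∀ i j, ‖(inner ℂ (u i) (u j) : ℂ) - if i = j then 1 else 0‖ ≤ e ∧
        ‖(inner ℂ (u i) (A (u j)) : ℂ) - if i = j then (ev i : ℂ) else 0‖ ≤ e := by
    refine (Filter.eventually_all.2 fun i => ?_).and
      (Filter.eventually_all.2 fun i => Filter.eventually_all.2 fun j => .and ?_ ?_)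
    · have hc : Continuous fun u : Fin (2 ^ n) → Qubits n => ‖u i‖ := by fun_prop
      exact hc.continuousAt.eventually_le_const (by dsimp only; rw [b.norm_eq_one]; norm_num)
    · have hc : Continuous fun u : Fin (2 ^ n) → Qubits n =>
        ‖(inner ℂ (u i) (u j) : ℂ) - if i = j then 1 else 0‖ := by fun_prop
      refine hc.continuousAt.eventually_le_const ?_
      dsimp only
      rw [orthonormal_iff_ite.1 b.orthonormal i j, sub_self, norm_zero]
      exact he
    · have hc : Continuous fun u : Fin (2 ^ n) → Qubits n =>
        ‖(inner ℂ (u i) (A (u j)) : ℂ) - if i = j then (ev i : ℂ) else 0‖ := by fun_prop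
      refine hc.continuousAt.eventually_le_const ?_
      dsimp only
      rw [hb, inner_smul_right, orthonormal_iff_ite.1 b.orthonormal i j]
      split_ifs with h
      · subst h; simpa using he
      · simpa using he
  have hdense : DenseRange (Pi.map fun _ : Fin (2 ^ n) => VecCode.toQubits n) :=
    DenseRange.piMap fun _ => VecCode.denseRange_toQubits n
  obtain ⟨_, ⟨r, rfl⟩, hr⟩ := hdense.inter_nhds_nonempty hopen
  exact ⟨r, hr⟩

/-- A splitting of the index set into two lists. -/
theorem exists_split_list {N : ℕ} (p : Fin N → Prop) :
    ∃ l l' : List (Fin N), (l ++ l').length = N ∧ (l ++ l').Nodup ∧ (∀ i ∈ l, p i) ∧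
      ∀ i ∈ l', ¬ p i := by
  classical
  have h := List.filter_append_perm (fun i => decide (p i)) (List.finRange N)
  refine ⟨_, _, h.length_eq.trans List.length_finRange, h.nodup_iff.2 (List.nodup_finRange N),
    fun i hi => ?_, fun i hi => ?_⟩
  · simpa using List.of_mem_filter hi
  · simpa using List.of_mem_filter hi

theorem Certificate.vec_map {N : ℕ} (r : Fin N → VecCode) (l l' : List (Fin N)) (g : ℕ × ℕ) {i : ℕ}
    (hi : i < (l ++ l').length) :
    Certificate.vec ((l.map r, l'.map r), g) i = r (l ++ l')[i] := by
  rw [Certificate.vec]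
  dsimp only
  rw [← List.map_append, List.getD_eq_getElem _ _ (by rwa [List.length_map]), List.getElem_map]

/-- Every input that describes a machine has an accepted certificate. -/
theorem Describes.exists_accepts {x : Input} (h : x.1.Describes M) (hD : 0 < x.2.2.2.2) :
    ∃ c, Accepts x c := by
  classical
  obtain ⟨b, ev, g, hg, hb, hgap⟩ := M.exists_eigenbasis x.2.1 x.2.2.1
  -- Tolerance and precision depend on a certificate only through `g`. They can therefore be fixed
  -- before the vectors and the fuel are chosen to meet them.
  set X := tolerance x (([], []), g, 0) with hX
  have hX0 : 0 < X := tolerance_pos hD hg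
  have hX1 : (0 : ℝ) < X := by exact_mod_cast hX0
  obtain ⟨r, hr2, hr⟩ := exists_coded_eigenbasis (M.defectOp x.2.1 x.2.2.1) b ev hb
    (e := 1 / (2 * X)) (by positivity)
  obtain ⟨fuel, hfuel⟩ := h.exists_fuel (precision x (([], []), g, 0))
  obtain ⟨l, l', hlen, hnodup, hl, hl'⟩ := exists_split_list fun i => ev i = 0
  set c : Certificate := ((l.map r, l'.map r), g, fuel) with hc
  have hcX : tolerance x c = X := rfl
  have hcg : c.2.1 = g := rfl
  have hf : Fueled x c := hfuel
  have hvec {i : ℕ} (hi : i < 2 ^ x.2.1) : c.vec i = r ((l ++ l')[i]'(by rwa [hlen])) :=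
    Certificate.vec_map r l l' _ _
  -- The tolerance is shared equally between the rounding of the eigenvectors and the error of the
  -- simulation.
  have hhalf : 1 / (2 * (X : ℝ)) + 1 / (2 * X) = 1 / X := by field_simp; norm_num
  have hle : 1 / (2 * (X : ℝ)) ≤ 1 / X := by
    have : 0 < 1 / (2 * (X : ℝ)) := by positivity
    linarith
  refine ⟨c, ⟨by simpa [hc] using hlen, hg⟩, hf, fun i hi j hj => ?_⟩
  set i' := (l ++ l')[i]'(by rwa [hlen]) with hi'
  set j' := (l ++ l')[j]'(by rwa [hlen]) with hj'
  have hij : i' = j' ↔ i = j := hnodup.getElem_inj_iff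
  have hentry : ‖(entry x c i j).val - inner ℂ ((r i').toQubits x.2.1)
      (M.defectOp x.2.1 x.2.2.1 ((r j').toQubits x.2.1))‖ ≤ 1 / (2 * X) := by
    have h1 := QTMCode.norm_entry_sub_le (i := i) (j := j) h hf (hcX ▸ hX0)
      (by rw [hvec hi]; exact hr2 _) (by rw [hvec hj]; exact hr2 _)
    rwa [hvec hi, hvec hj, hcX] at h1
  obtain ⟨hr3, hr4⟩ := hr i' j'
  constructor
  · rw [GaussCode.small_iff, hcX, ← le_div_iff₀' hX1]
    have h1 := val_gram_sub_delta h c ⟨i, hi⟩ ⟨j, hj⟩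
    dsimp only at h1
    rw [h1, Certificate.vector, Certificate.vector]
    dsimp only
    rw [hvec hi, hvec hj]
    simp only [Fin.mk.injEq]
    simpa only [hij] using hr3.trans hle
  · split_ifs with hd
    · obtain ⟨rfl, hi2⟩ := hd
      have hev : ev i' ≠ 0 := by
        refine hl' _ ?_
        have hi3 : l.length ≤ i := by simpa [hc] using hi2
        rw [hi', List.getElem_append_right hi3]
        exact List.getElem_mem _
      have h3 := (hgap i').resolve_left hev
      have hg' : (0 : ℝ) < g := by exact_mod_cast hg
      rw [GaussCode.small_iff, not_le, hcg, ← div_lt_iff₀' hg']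
      rw [if_pos (hij.2 rfl)] at hr4
      have h4 := norm_sub_le_norm_sub_add_norm_sub (ev i' : ℂ) (inner ℂ ((r i').toQubits x.2.1)
        (M.defectOp x.2.1 x.2.2.1 ((r i').toQubits x.2.1))) (entry x c i i).val
      rw [norm_sub_rev] at hr4 hentry
      have h5 := norm_le_norm_add_norm_sub (entry x c i i).val (ev i' : ℂ)
      have h6 : ev i' ≤ ‖(ev i' : ℂ)‖ := by
        rw [Complex.norm_real]; exact le_abs_self _
      have h7 : 1 / (X : ℝ) ≤ 1 / g := by
        apply one_div_le_one_div_of_le hg'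
        have : g ≤ X := by
          rw [hX]
          unfold tolerance
          dsimp only
          rw [show 128 * 2 ^ x.2.1 * g * x.2.2.2.2 ^ 2 =
            g * (128 * 2 ^ x.2.1 * x.2.2.2.2 ^ 2) by ring]
          exact Nat.le_mul_of_pos_right _ (by positivity)
        exact_mod_cast this
      have h8 : 3 / (g : ℝ) = 3 * (1 / g) := by ring
      have h9 : 0 < 1 / (g : ℝ) := by positivity
      have h10 : ‖(entry x c i i).val - (ev i' : ℂ)‖ ≤ 1 / X := by
        rw [norm_sub_rev]
        exact h4.trans ((add_le_add hr4 hentry).trans_eq hhalf)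
      linarith
    · rw [GaussCode.small_iff, hcX, ← le_div_iff₀' hX1]
      have h1 : ‖(inner ℂ ((r i').toQubits x.2.1)
          (M.defectOp x.2.1 x.2.2.1 ((r j').toQubits x.2.1)) : ℂ)‖ ≤ 1 / (2 * X) := by
        have h0 : (if i' = j' then (ev i' : ℂ) else 0) = 0 := by
          split_ifs with h2
          · have hi3 : i < l.length := by
              by_contra h4
              exact hd ⟨hij.1 h2, by simpa [hc] using h4⟩
            have : ev i' = 0 := by
              refine hl _ ?_
              rw [hi', List.getElem_append_left hi3]
              exact List.getElem_mem _
            rw [this, Complex.ofReal_zero]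
          · rfl
        rwa [h0, sub_zero] at hr4
      have h2 := norm_le_norm_add_norm_sub' (entry x c i j).val (inner ℂ ((r i').toQubits x.2.1)
          (M.defectOp x.2.1 x.2.2.1 ((r j').toQubits x.2.1)))
      linarith

/-- The search finds an accepted certificate. -/
theorem Describes.exists_mem_search {x : Input} (h : x.1.Describes M) (hD : 0 < x.2.2.2.2) :
    ∃ c, Accepts x c ∧ output x c ∈ search x := by
  obtain ⟨c₀, hc₀⟩ := h.exists_accepts hD
  have hdom : (search x).Dom := by
    refine Nat.rfindOpt_dom.2 ⟨Encodable.encode c₀, output x c₀, ?_⟩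
    rw [Encodable.encodek, Option.bind_some, if_pos hc₀]
    rfl
  -- The search may stop at a certificate other than `c₀`; only its acceptance is known and used.
  obtain ⟨out, hout⟩ := Part.dom_iff_mem.1 hdom
  obtain ⟨m, hm⟩ := Nat.rfindOpt_spec hout
  rw [Option.mem_def, Option.bind_eq_some_iff] at hm
  obtain ⟨c, -, hc⟩ := hm
  split_ifs at hc with ha
  rw [Option.some_inj] at hc
  exact ⟨c, ha, hc ▸ hout⟩

end QTMCode

/-! ### Halting spaces for rational accuracies -/

namespace QTMCode

open QTuring

variable {M : QTM} {s : QTMCode}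

/-- The certificate that the search finds. -/
noncomputable def Describes.certificate (h : s.Describes M) (n t : ℕ) (δ : ℚ) : Certificate :=
  (h.exists_mem_search (x := (s, n, t, RatCode.ofRat δ)) δ.den_pos).choose

theorem Describes.certificate_accepts (h : s.Describes M) (n t : ℕ) (δ : ℚ) :
    Accepts (s, n, t, RatCode.ofRat δ) (h.certificate n t δ) :=
  (h.exists_mem_search (x := (s, n, t, RatCode.ofRat δ)) δ.den_pos).choose_spec.1

theorem Describes.output_mem (h : s.Describes M) (n t : ℕ) (δ : ℚ) :
    output (s, n, t, RatCode.ofRat δ) (h.certificate n t δ) ∈ search (s, n, t, RatCode.ofRat δ) :=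
  (h.exists_mem_search (x := (s, n, t, RatCode.ofRat δ)) δ.den_pos).choose_spec.2

/-- The accuracy that belongs to the certificate. -/
noncomputable def Describes.accuracy (h : s.Describes M) (n t : ℕ) (δ : ℚ) : ℚ :=
  1 / (8 * (t + 1) * (h.certificate n t δ).2.1 * δ.den ^ 2)

theorem Describes.accuracy_pos (h : s.Describes M) (n t : ℕ) (δ : ℚ) : 0 < h.accuracy n t δ := by
  have hg : (0 : ℚ) < (h.certificate n t δ).2.1 := by
    exact_mod_cast (h.certificate_accepts n t δ).1.2
  have hD : (0 : ℚ) < δ.den := by exact_mod_cast δ.den_pos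
  unfold accuracy
  positivity

/-- The numerator of a positive rational is at least `1`. Hence accuracy `1/D` suffices, and the
algorithm uses only the denominator of `δ`. -/
theorem _root_.Rat.one_div_den_le {δ : ℚ} (h : 0 < δ) : (1 / (δ.den : ℝ)) ≤ δ := by
  have h1 : (1 : ℤ) ≤ δ.num := Rat.num_pos.2 h
  have h2 : (1 : ℝ) ≤ δ.num := by exact_mod_cast h1
  have h3 : (δ : ℝ) = δ.num / δ.den := Rat.cast_def δ
  rw [h3]
  gcongr

theorem Describes.isEpsHalting (h : s.Describes M) {n t : ℕ} {δ : ℚ} (hδ : 0 < δ) {ψ : Qubits n}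
    (hψ : ψ ∈ (h.certificate n t δ).space n) (h1 : ‖ψ‖ = 1) : M.IsEpsHalting (20 * δ) t ψ := by
  refine M.isEpsHalting_of_re_inner_defectOp_le h1
    (((h.certificate_accepts n t δ).re_inner_le h δ.den_pos hψ h1).trans ?_)
  have h2 := Rat.one_div_den_le hδ
  have h3 : (0 : ℝ) < δ := by exact_mod_cast hδ
  change 1 / (δ.den : ℝ) ≤ _
  linarith

/-- The common source of approximation (`ε = 0`) and of similarity (`ε = 20δ`, with the accuracy
taken at `Δ`). -/
theorem Describes.exists_near (h : s.Describes M) {n t : ℕ} {δ : ℚ} (hδ : 0 < δ) {ψ : Qubits n}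
    {ε : ℝ} (hε : ε ≤ (h.accuracy n t δ : ℝ) / 4) (hψ : M.IsEpsHalting ε t ψ) :
    ∃ φ ∈ (h.certificate n t δ).space n, ‖φ‖ = 1 ∧ ‖ψ - φ‖ < 11 / 2 * (δ : ℝ) := by
  have hg : (0 : ℝ) < (h.certificate n t δ).2.1 := by
    exact_mod_cast (h.certificate_accepts n t δ).1.2
  have hD : (0 : ℝ) < δ.den := by exact_mod_cast δ.den_pos
  have h2 : (inner ℂ ψ (M.defectOp n t ψ)).re ≤
      1 / (32 * (h.certificate n t δ).2.1 * δ.den ^ 2) := by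
    refine hψ.re_inner_defectOp_le.trans ?_
    calc ((t : ℝ) + 1) * ε ≤ (t + 1) * ((h.accuracy n t δ : ℝ) / 4) := by gcongr
      _ = _ := by
        unfold accuracy
        push_cast
        field_simp
        norm_num
  obtain ⟨φ, hφ, h3, h4⟩ := (h.certificate_accepts n t δ).exists_near h δ.den_pos hψ.1 h2
  refine ⟨φ, hφ, h3, h4.trans_lt ?_⟩
  have h5 := Rat.one_div_den_le hδ
  have h6 : (0 : ℝ) < δ := by exact_mod_cast hδ
  change 1 / (δ.den : ℝ) < _
  linarith

theorem val_output (h : s.Describes M) (n t : ℕ) (δ : ℚ) :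
    RatCode.val (output (s, n, t, RatCode.ofRat δ) (h.certificate n t δ)).2 =
      h.accuracy n t δ := by
  simp only [output, RatCode.val, Describes.accuracy, RatCode.ofRat]
  push_cast
  rfl

end QTMCode

theorem mainTheorem5 :
    ∃ alg : QTMCode × ℕ × ℕ × RatCode →. List VecCode × RatCode,
      Partrec alg ∧
      ∀ (M : QTM) (s : QTMCode), s.Describes M →
        ∃ (space : (n : ℕ) → ℕ → ℚ → Submodule ℂ (Qubits n)) (acc : ℕ → ℕ → ℚ → ℚ),
          -- the algorithm computes the subspaces and the accuracies
          (∀ (n t : ℕ) (δ : ℚ), 0 < t → 0 < δ →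
            0 < acc n t δ ∧
            ∃ out ∈ alg (s, n, t, RatCode.ofRat δ),
              DescribesSubspace out.1 (space n t δ) ∧ RatCode.val out.2 = acc n t δ) ∧
          -- almost-halting
          (∀ (n t : ℕ) (δ : ℚ), 0 < t → 0 < δ →
            ∀ ψ ∈ space n t δ, ‖ψ‖ = 1 → M.IsEpsHalting (20 * (δ : ℝ)) t ψ) ∧
          -- approximation
          (∀ (n t : ℕ) (δ : ℚ), 0 < t → 0 < δ →
            ∀ ψ : Qubits n, M.IsHalting t ψ →
              ∃ φ ∈ space n t δ, ‖φ‖ = 1 ∧ ‖ψ - φ‖ < 11 / 2 * (δ : ℝ)) ∧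
          -- similarity
          (∀ (n t : ℕ) (δ Δ : ℚ), 0 < t → 0 < δ → 0 < Δ → δ ≤ 1 / 80 * acc n t Δ →
            ∀ ψ ∈ space n t δ, ‖ψ‖ = 1 →
              ∃ φ ∈ space n t Δ, ‖φ‖ = 1 ∧ ‖ψ - φ‖ < 11 / 2 * (Δ : ℝ)) ∧
          -- almost-orthogonality
          (∀ (n t t' : ℕ) (δ : ℚ), 0 < t → 0 < t' → t ≠ t' → 0 < δ →
            ∀ ψ ∈ space n t δ, ‖ψ‖ = 1 → ∀ ψ' ∈ space n t' δ, ‖ψ'‖ = 1 →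
              ‖(inner ℂ ψ ψ' : ℂ)‖ ≤ 4 * Real.sqrt (5 * (δ : ℝ))) := by
  refine ⟨QTMCode.search, QTMCode.partrec_search, fun M s h =>
    ⟨fun n t δ => (h.certificate n t δ).space n, h.accuracy, fun n t δ _ _ =>
      ⟨h.accuracy_pos n t δ, _, h.output_mem n t δ,
        (h.certificate_accepts n t δ).describesSubspace h δ.den_pos,
        QTMCode.val_output h n t δ⟩,
      fun n t δ _ hδ ψ hψ h1 => h.isEpsHalting hδ hψ h1,
      fun n t δ _ hδ ψ hψ => h.exists_near hδ ?_ hψ.isEpsHalting,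
      fun n t δ Δ _ hδ hΔ hle ψ hψ h1 => h.exists_near hΔ ?_ (h.isEpsHalting hδ hψ h1),
      fun n t t' δ _ _ hne hδ ψ hψ h1 ψ' hψ' h1' => ?_⟩⟩
  · have : (0 : ℝ) < h.accuracy n t δ := by exact_mod_cast h.accuracy_pos n t δ
    linarith
  -- Multiplying `δ ≤ acc/80` by `20` gives `20δ ≤ acc/4`.
  · have hle' := (Rat.cast_le (K := ℝ)).2 hle
    push_cast at hle'
    linarith
  · have hψε := h.isEpsHalting hδ hψ h1
    have hψε' := h.isEpsHalting hδ hψ' h1'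
    have hsqrt : 2 * Real.sqrt (20 * (δ : ℝ)) = 4 * Real.sqrt (5 * (δ : ℝ)) := by
      rw [show (20 : ℝ) * δ = 2 ^ 2 * (5 * δ) by ring, Real.sqrt_mul (by norm_num),
        Real.sqrt_sq (by norm_num)]
      ring
    rw [← hsqrt]
    -- The estimate compares the vectors at the earlier halting time, so the order of the two times
    -- decides their roles.
    rcases lt_or_gt_of_ne hne with hlt | hlt
    · exact hψε.norm_inner_le hψε' hlt
    · rw [norm_inner_symm]
      exact hψε'.norm_inner_le hψε hlt
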